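/- Let $\mathcal H_A,\mathcal H_B$ be complex Hilbert spaces of arbitrary (possibly infinite) dimension, and let $\mathcal H_{AB}=\mathcal H_A\otimes\mathcal H_B$ be their Hilbert space tensor product. A state on a Hilbert space $\mathcal H$ is a positive trace-class operator on $\mathcal H$ of trace $1$. Let $\mathcal S_1$ be the Banach space of trace-class operators on $\mathcal H_{AB}$ with the trace norm $\|\lambda\|_{\mathcal S_1}=\operatorname{Tr}(\lambda^*\lambda)^{1/2}$. A state $\Gamma$ on $\mathcal H_{AB}$ is called separable if it lies in $$\Sigma_{\rm sep}=\overline{\operatorname{conv}\{\gamma_A\otimes\gamma_B:\ \gamma_A\text{ a state on }\mathcal H_A,\ \gamma_B\text{ a state on }\mathcal H_B\}},$$ the closure being taken in the trace norm, and entangled otherwise. Let $\mathcal P=\{P_\Psi=|\Psi\rangle\langle\Psi|:\ \Psi\in\mathcal H_{AB},\ \|\Psi\|=1\}\subset\mathcal S_1$ be the metric space of pure states. The Schmidt rank $r_S(\Psi)\in\{1,2,\dots\}\cup\{\infty\}$ of a unit vector $\Psi$ is the number $n$ of its nonzero Schmidt coefficients, i.e. $\Psi=\sum_{i=1}^n c_i\,e_i\otimes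 f_i$ with $c_i>0$ and orthonormal systems $(e_i)$ in $\mathcal H_A$, $(f_i)$ in $\mathcal H_B$, and $r_S(\Psi)=\infty$ if there is no such finite decomposition; it depends only on $P_\Psi$. The Schmidt number of a state $\Gamma$ on $\mathcal H_{AB}$ is $$n_S(\Gamma)=\inf_{\mu}\ \operatorname*{ess\,sup}_{P_\Psi\sim\mu}\ r_S(\Psi),$$ where the infimum is over all Borel probability measures $\mu$ on $\mathcal P$ with $\int_{\mathcal P}P_\Psi\,d\mu(P_\Psi)=\Gamma$ (Bochner integral in $\mathcal S_1$). Theorem. For every state $\Gamma$ on $\mathcal H_{AB}$, $$\Gamma\ \text{is entangled}\iff n_S(\Gamma)>1,\qquad \Gamma\ \text{is separable}\iff n_S(\Gamma)=1.$$ -/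

import Mathlib

open scoped ENNReal TensorProduct
open MeasureTheory

noncomputable section

namespace SchmidtNumber

section TraceNorm

set_option linter.unusedSectionVars false

variable {H : Type*} [NormedAddCommGroup H] [InnerProductSpace ℂ H] [CompleteSpace H]

/-- The index set of a fixed orthonormal basis of the Hilbert space `H`. -/
def basisIndex (H : Type*) [NormedAddCommGroup H] [InnerProductSpace ℂ H] [CompleteSpace H] :
    Set H :=
  (exists_hilbertBasis ℂ H).choose

/-- A fixed orthonormal basis of the Hilbert space `H`. -/
def basis (H : Type*) [NormedAddCommGroup H] [InnerProductSpace ℂ H] [CompleteSpace H] :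
    HilbertBasis (basisIndex H) ℂ H :=
  (exists_hilbertBasis ℂ H).choose_spec.choose

/-- The trace norm `Tr |T|` of a bounded operator, as an element of `[0, ∞]`: the sum of the
diagonal matrix elements of the positive operator `|T| = sqrt (T^* T)` in an orthonormal basis.
It does not depend on the basis, see `traceNorm_eq_tsum`. -/
def traceNorm (T : H →L[ℂ] H) : ℝ≥0∞ :=
  ∑' i, ENNReal.ofReal (RCLike.re (inner ℂ (basis H i) (CFC.abs T (basis H i))))

/-- The squared Hilbert-Schmidt norm in a given orthonormal basis (auxiliary, used only in the
proof that the trace norm is a complete norm). -/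
def hsSum {ι : Type*} (b : HilbertBasis ι ℂ H) (S : H →L[ℂ] H) : ℝ≥0∞ :=
  ∑' i, ‖S (b i)‖ₑ ^ 2

theorem parseval {ι : Type*} (b : HilbertBasis ι ℂ H) (x : H) :
    ‖x‖ₑ ^ 2 = ∑' i, ‖inner ℂ (b i) x‖ₑ ^ 2 := by
  have h1 : HasSum (fun i => ‖inner ℂ (b i) x‖ ^ 2) (‖x‖ ^ 2) := by
    have h := Complex.hasSum_re (b.hasSum_inner_mul_inner x x)
    have e : (inner ℂ x x : ℂ).re = ‖x‖ ^ 2 := by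
      simpa using (inner_self_eq_norm_sq (𝕜 := ℂ) x)
    rw [e] at h
    convert h using 2 with i
    rw [← inner_conj_symm x (b i), mul_comm, Complex.mul_conj, Complex.normSq_eq_norm_sq,
      Complex.ofReal_re]
  rw [← ofReal_norm, ← ENNReal.ofReal_pow (norm_nonneg _), ← h1.tsum_eq,
    ENNReal.ofReal_tsum_of_nonneg (fun _ => by positivity) h1.summable]
  refine tsum_congr fun i => ?_
  rw [← ofReal_norm, ENNReal.ofReal_pow (norm_nonneg _)]

theorem hsSum_adjoint {ι κ : Type*} (b : HilbertBasis ι ℂ H) (c : HilbertBasis κ ℂ H)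
    (S : H →L[ℂ] H) : hsSum b S = hsSum c (ContinuousLinearMap.adjoint S) := by
  unfold hsSum
  simp_rw [parseval c (S _), parseval b (ContinuousLinearMap.adjoint S _)]
  rw [ENNReal.tsum_comm]
  refine tsum_congr fun j => tsum_congr fun i => ?_
  rw [ContinuousLinearMap.adjoint_inner_right, ← inner_conj_symm, RCLike.enorm_conj]

theorem hsSum_comp_left {ι : Type*} (b : HilbertBasis ι ℂ H) (W S : H →L[ℂ] H) (hW : ‖W‖ ≤ 1) :
    hsSum b (W ∘L S) ≤ hsSum b S := by
  refine ENNReal.tsum_le_tsum fun i => ?_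
  gcongr
  rw [← ofReal_norm, ← ofReal_norm]
  refine ENNReal.ofReal_le_ofReal ?_
  exact (W.le_of_opNorm_le hW _).trans (by simp)

open ContinuousLinearMap in
theorem exists_polar (T : H →L[ℂ] H) :
    ∃ V : H →L[ℂ] H, ‖V‖ ≤ 1 ∧ V ∘L CFC.abs T = T ∧ adjoint V ∘L T = CFC.abs T := by
  set A := CFC.abs T with hA
  have hsa : adjoint A = A := (CFC.abs_nonneg T).isSelfAdjoint.star_eq
  have hin : ∀ x y, inner ℂ (T x) (T y) = inner ℂ (A x) (A y) := by
    intro x y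
    have h := CFC.abs_mul_abs T
    rw [← adjoint_inner_right, ← adjoint_inner_right, hsa]
    congr 1
    exact (congrArg (fun S : H →L[ℂ] H => S y) h).symm
  have hno : ∀ x, ‖T x‖ = ‖A x‖ := by
    intro x
    rw [norm_eq_sqrt_re_inner (𝕜 := ℂ), norm_eq_sqrt_re_inner (𝕜 := ℂ) (A x), hin]
  let K := (LinearMap.range A.toLinearMap).topologicalClosure
  let e : H →ₗ[ℂ] K := A.toLinearMap.codRestrict K
    (fun x => Submodule.le_topologicalClosure _ ⟨x, rfl⟩)
  have hd : DenseRange e := by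
    intro y
    rw [closure_subtype]
    have hy : (y : H) ∈ closure ((LinearMap.range A.toLinearMap : Submodule ℂ H) : Set H) := y.2
    refine closure_mono ?_ hy
    rintro _ ⟨x, rfl⟩
    exact ⟨e x, ⟨x, rfl⟩, rfl⟩
  have hb : ∀ x, ‖T.toLinearMap x‖ ≤ 1 * ‖e x‖ := fun x => by
    rw [one_mul]; exact (hno x).le
  let F : K →L[ℂ] H := T.toLinearMap.extendOfNorm e
  have hF : ∀ x, F (e x) = T x := LinearMap.extendOfNorm_eq hd ⟨1, hb⟩
  have hFn : ‖F‖ ≤ 1 := LinearMap.opNorm_extendOfNorm_le hd zero_le_one hb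
  have : CompleteSpace K := (Submodule.isClosed_topologicalClosure _).completeSpace_coe
  let P := K.orthogonalProjectionOnto
  refine ⟨F ∘L P, ?_, ?_, ?_⟩
  · refine (opNorm_comp_le _ _).trans ?_
    exact mul_le_one₀ hFn (norm_nonneg _) (Submodule.orthogonalProjectionOnto_norm_le K)
  · ext x
    have : P (A x) = e x := Submodule.orthogonalProjectionOnto_mem_subspace_eq_self (e x)
    simp [this, hF]
  · ext x
    refine ext_inner_right ℂ fun y => ?_
    have key : ∀ k : K, inner ℂ (T x) (F k) = inner ℂ (A x) (k : H) := by
      refine fun k => hd.induction_on (p := fun k : K => inner ℂ (T x) (F k) = inner ℂ (A x) (k : H))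
         k (isClosed_eq (by fun_prop) (by fun_prop)) fun z => ?_
      rw [hF, hin]; rfl
    rw [comp_apply, adjoint_inner_left, comp_apply, key]
    exact Submodule.inner_orthogonalProjectionOnto_eq_of_mem_left (e x) y

/-- The square root of `|T|` (auxiliary). -/
def absSqrt (T : H →L[ℂ] H) : H →L[ℂ] H := CFC.sqrt (CFC.abs T)

theorem adjoint_absSqrt (T : H →L[ℂ] H) :
    ContinuousLinearMap.adjoint (absSqrt T) = absSqrt T :=
  (CFC.sqrt_nonneg (CFC.abs T)).isSelfAdjoint.star_eq

theorem absSqrt_comp (T : H →L[ℂ] H) : absSqrt T ∘L absSqrt T = CFC.abs T :=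
  CFC.sqrt_mul_sqrt_self (CFC.abs T) (CFC.abs_nonneg T)

theorem hsSum_absSqrt {ι : Type*} (b : HilbertBasis ι ℂ H) (T : H →L[ℂ] H) :
    hsSum b (absSqrt T) = ∑' i, ENNReal.ofReal (RCLike.re (inner ℂ (b i) (CFC.abs T (b i)))) := by
  refine tsum_congr fun i => ?_
  have h : inner ℂ (b i) (CFC.abs T (b i)) = inner ℂ (absSqrt T (b i)) (absSqrt T (b i)) := by
    rw [← absSqrt_comp, ContinuousLinearMap.comp_apply,
      ← ContinuousLinearMap.adjoint_inner_left, adjoint_absSqrt]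
  rw [h, inner_self_eq_norm_sq, ← ofReal_norm, ENNReal.ofReal_pow (norm_nonneg _)]

theorem traceNorm_eq_hsSum {ι : Type*} (b : HilbertBasis ι ℂ H) (T : H →L[ℂ] H) :
    traceNorm T = hsSum b (absSqrt T) := by
  rw [traceNorm, ← hsSum_absSqrt, hsSum_adjoint (basis H) b, adjoint_absSqrt]

/-- The trace norm can be computed in any orthonormal basis. -/
theorem traceNorm_eq_tsum {ι : Type*} (b : HilbertBasis ι ℂ H) (T : H →L[ℂ] H) :
    traceNorm T = ∑' i, ENNReal.ofReal (RCLike.re (inner ℂ (b i) (CFC.abs T (b i)))) := by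
  rw [traceNorm_eq_hsSum b, hsSum_absSqrt]

theorem tsum_enorm_inner_le {ι : Type*} (b : HilbertBasis ι ℂ H) (W T : H →L[ℂ] H)
    (hW : ‖W‖ ≤ 1) : ∑' i, ‖inner ℂ (b i) (W (T (b i)))‖ₑ ≤ traceNorm T := by
  obtain ⟨V, hV, hVT, -⟩ := exists_polar T
  set R := absSqrt T with hR
  set S := ContinuousLinearMap.adjoint ((W ∘L V) ∘L R) with hS
  have hWV : ‖W ∘L V‖ ≤ 1 :=
    (ContinuousLinearMap.opNorm_comp_le _ _).trans (mul_le_one₀ hW (norm_nonneg _) hV)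
  have h1 : ∀ i, inner ℂ (b i) (W (T (b i))) = inner ℂ (S (b i)) (R (b i)) := by
    intro i
    rw [hS, ContinuousLinearMap.adjoint_inner_left]
    conv_lhs => rw [← hVT, ← absSqrt_comp]
    rfl
  have h2 : ∀ i, 2 * ‖inner ℂ (b i) (W (T (b i)))‖ₑ ≤ ‖S (b i)‖ₑ ^ 2 + ‖R (b i)‖ₑ ^ 2 := by
    intro i
    rw [h1]
    have h3 : ‖inner ℂ (S (b i)) (R (b i))‖₊ ≤ ‖S (b i)‖₊ * ‖R (b i)‖₊ :=
      nnnorm_inner_le_nnnorm _ _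
    have h4 : 2 * ‖inner ℂ (S (b i)) (R (b i))‖₊ ≤ ‖S (b i)‖₊ ^ 2 + ‖R (b i)‖₊ ^ 2 := by
      refine le_trans ?_ (two_mul_le_add_sq _ _)
      rw [mul_assoc]
      gcongr
    simp only [enorm_eq_nnnorm]
    exact_mod_cast h4
  have h5 : 2 * ∑' i, ‖inner ℂ (b i) (W (T (b i)))‖ₑ ≤ 2 * traceNorm T := by
    rw [← ENNReal.tsum_mul_left]
    refine (ENNReal.tsum_le_tsum h2).trans ?_
    rw [ENNReal.tsum_add, two_mul]
    have h6 : hsSum b S ≤ traceNorm T := by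
      rw [hS, ← hsSum_adjoint b b, traceNorm_eq_hsSum b]
      exact hsSum_comp_left b _ _ hWV
    exact add_le_add h6 (traceNorm_eq_hsSum b T).ge
  exact (ENNReal.mul_le_mul_iff_right two_ne_zero ENNReal.ofNat_ne_top).1 h5

theorem traceNorm_le_of_polar {T V : H →L[ℂ] H}
    (hV : ContinuousLinearMap.adjoint V ∘L T = CFC.abs T) :
    traceNorm T ≤
      ∑' i, ‖inner ℂ (basis H i) (ContinuousLinearMap.adjoint V (T (basis H i)))‖ₑ := by
  refine ENNReal.tsum_le_tsum fun i => ?_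
  rw [← hV, ← ofReal_norm]
  exact ENNReal.ofReal_le_ofReal (RCLike.re_le_norm _)

theorem norm_adjoint_le_one {V : H →L[ℂ] H} (hV : ‖V‖ ≤ 1) :
    ‖ContinuousLinearMap.adjoint V‖ ≤ 1 := by
  rwa [LinearIsometryEquiv.norm_map]

theorem traceNorm_add_le (S T : H →L[ℂ] H) :
    traceNorm (S + T) ≤ traceNorm S + traceNorm T := by
  obtain ⟨V, hV, -, hVT⟩ := exists_polar (S + T)
  refine (traceNorm_le_of_polar hVT).trans ?_
  refine le_trans ?_ (add_le_add
    (tsum_enorm_inner_le (basis H) _ S (norm_adjoint_le_one hV))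
    (tsum_enorm_inner_le (basis H) _ T (norm_adjoint_le_one hV)))
  rw [← ENNReal.tsum_add]
  refine ENNReal.tsum_le_tsum fun i => ?_
  rw [add_apply, map_add, inner_add_right]
  exact enorm_add_le _ _

theorem traceNorm_smul (c : ℂ) (T : H →L[ℂ] H) :
    traceNorm (c • T) = ‖c‖ₑ * traceNorm T := by
  rw [traceNorm, traceNorm, ← ENNReal.tsum_mul_left]
  refine tsum_congr fun i => ?_
  have h : CFC.abs (c • T) = (‖c‖ : ℂ) • CFC.abs T := by
    rw [CFC.abs_smul]
    ext x
    simp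
  rw [h, smul_apply, inner_smul_right, ← ofReal_norm,
    ← ENNReal.ofReal_mul (norm_nonneg _)]
  simp

theorem traceNorm_zero : traceNorm (0 : H →L[ℂ] H) = 0 := by
  simpa using traceNorm_smul (0 : ℂ) (0 : H →L[ℂ] H)

theorem enorm_le_traceNorm (T : H →L[ℂ] H) : ‖T‖ₑ ≤ traceNorm T := by
  have h1 : ‖absSqrt T‖ₑ ^ 2 ≤ traceNorm T := by
    by_cases htop : traceNorm T = ⊤
    · simp [htop]
    have hx : ∀ x, ‖absSqrt T x‖ ^ 2 ≤ (traceNorm T).toReal * ‖x‖ ^ 2 := by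
      intro x
      have h2 : ‖absSqrt T x‖ₑ ^ 2 ≤ traceNorm T * ‖x‖ₑ ^ 2 := by
        rw [parseval (basis H), traceNorm_eq_hsSum (basis H), hsSum, ← ENNReal.tsum_mul_right]
        refine ENNReal.tsum_le_tsum fun i => ?_
        rw [← mul_pow, ← ContinuousLinearMap.adjoint_inner_left, adjoint_absSqrt]
        gcongr
        simp only [enorm_eq_nnnorm]
        exact_mod_cast nnnorm_inner_le_nnnorm (𝕜 := ℂ) _ _
      have h3 := ENNReal.toReal_mono (ENNReal.mul_ne_top htop (by simp)) h2
      simpa using h3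
    have h4 : ‖absSqrt T‖ ≤ Real.sqrt (traceNorm T).toReal := by
      refine ContinuousLinearMap.opNorm_le_bound _ (Real.sqrt_nonneg _) fun x => ?_
      rw [← Real.sqrt_sq (norm_nonneg x), ← Real.sqrt_mul ENNReal.toReal_nonneg]
      exact Real.le_sqrt_of_sq_le (hx x)
    have h5 : ‖absSqrt T‖ ^ 2 ≤ (traceNorm T).toReal := by
      calc ‖absSqrt T‖ ^ 2 ≤ Real.sqrt (traceNorm T).toReal ^ 2 := by gcongr
        _ = _ := Real.sq_sqrt ENNReal.toReal_nonneg
    rw [← ofReal_norm, ← ENNReal.ofReal_pow (norm_nonneg _), ← ENNReal.ofReal_toReal htop]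
    exact ENNReal.ofReal_le_ofReal h5
  refine le_trans ?_ h1
  rw [← ofReal_norm, ← ofReal_norm, ← ENNReal.ofReal_pow (norm_nonneg _)]
  refine ENNReal.ofReal_le_ofReal ?_
  rw [← CFC.norm_abs, ← absSqrt_comp, sq]
  exact ContinuousLinearMap.opNorm_comp_le _ _

open Filter Topology in
theorem traceNorm_le_of_tendsto {S : ℕ → H →L[ℂ] H} {T : H →L[ℂ] H} {C : ℝ≥0∞}
    (hS : Tendsto S atTop (𝓝 T)) (hC : ∀ᶠ n in atTop, traceNorm (S n) ≤ C) :
    traceNorm T ≤ C := by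
  obtain ⟨V, hV, -, hVT⟩ := exists_polar T
  refine (traceNorm_le_of_polar hVT).trans ?_
  rw [ENNReal.tsum_eq_iSup_sum]
  refine iSup_le fun F => ?_
  have hlim : Tendsto (fun n => ∑ i ∈ F,
      ‖inner ℂ (basis H i) (ContinuousLinearMap.adjoint V (S n (basis H i)))‖ₑ) atTop
      (𝓝 (∑ i ∈ F, ‖inner ℂ (basis H i) (ContinuousLinearMap.adjoint V (T (basis H i)))‖ₑ)) := by
    refine tendsto_finsetSum _ fun i _ => ?_
    have hc : Continuous fun A : H →L[ℂ] H =>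
        ‖inner ℂ (basis H i) (ContinuousLinearMap.adjoint V (A (basis H i)))‖ₑ := by fun_prop
    exact (hc.tendsto T).comp hS
  refine le_of_tendsto hlim (hC.mono fun n hn => ?_)
  exact (ENNReal.sum_le_tsum F).trans
    ((tsum_enorm_inner_le (basis H) _ (S n) (norm_adjoint_le_one hV)).trans hn)

end TraceNorm

section TraceClass

variable (H : Type*) [NormedAddCommGroup H] [InnerProductSpace ℂ H] [CompleteSpace H]

/-- The linear space of trace-class operators: bounded operators with finite trace norm. -/
def traceClassSubmodule : Submodule ℂ (H →L[ℂ] H) where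
  carrier := {T | traceNorm T ≠ ⊤}
  add_mem' {S T} hS hT :=
    ne_top_of_le_ne_top (ENNReal.add_ne_top.2 ⟨hS, hT⟩) (traceNorm_add_le S T)
  zero_mem' := by simp [traceNorm_zero]
  smul_mem' c T hT := by
    simp only [Set.mem_ofPred_eq, traceNorm_smul]
    exact ENNReal.mul_ne_top enorm_ne_top hT

/-- The Schatten space `S_1` of trace-class operators on the Hilbert space `H`, which carries the
trace norm (and not the operator norm). -/
def TraceClass : Type _ := traceClassSubmodule H

instance : AddCommGroup (TraceClass H) := inferInstanceAs (AddCommGroup (traceClassSubmodule H))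

instance : Module ℂ (TraceClass H) := inferInstanceAs (Module ℂ (traceClassSubmodule H))

variable {H}

/-- The bounded operator underlying an element of the trace class. -/
def TraceClass.op (T : TraceClass H) : H →L[ℂ] H := T.1

theorem TraceClass.op_injective : Function.Injective (TraceClass.op : TraceClass H → _) :=
  Subtype.val_injective

theorem TraceClass.traceNorm_op_ne_top (T : TraceClass H) : traceNorm T.op ≠ ⊤ := T.2

theorem TraceClass.op_add (S T : TraceClass H) : (S + T).op = S.op + T.op := rfl

theorem TraceClass.op_sub (S T : TraceClass H) : (S - T).op = S.op - T.op := rfl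

theorem TraceClass.op_zero : (0 : TraceClass H).op = 0 := rfl

theorem TraceClass.op_smul (c : ℂ) (T : TraceClass H) : (c • T).op = c • T.op := rfl

instance : Norm (TraceClass H) := ⟨fun T => (traceNorm T.op).toReal⟩

theorem TraceClass.norm_def (T : TraceClass H) : ‖T‖ = (traceNorm T.op).toReal := rfl

theorem TraceClass.norm_op_le (T : TraceClass H) : ‖T.op‖ ≤ ‖T‖ := by
  have h := ENNReal.toReal_mono T.traceNorm_op_ne_top (enorm_le_traceNorm T.op)
  simpa [TraceClass.norm_def] using h

theorem traceClassCore : NormedSpace.Core ℂ (TraceClass H) where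
  norm_nonneg _ := ENNReal.toReal_nonneg
  norm_smul c T := by
    simp [TraceClass.norm_def, TraceClass.op_smul, traceNorm_smul]
  norm_triangle S T := by
    rw [TraceClass.norm_def, TraceClass.norm_def, TraceClass.norm_def,
      ← ENNReal.toReal_add S.traceNorm_op_ne_top T.traceNorm_op_ne_top]
    exact ENNReal.toReal_mono
      (ENNReal.add_ne_top.2 ⟨S.traceNorm_op_ne_top, T.traceNorm_op_ne_top⟩) (traceNorm_add_le _ _)
  norm_eq_zero_iff T := by
    constructor
    · intro h
      have h' := T.norm_op_le
      rw [h] at h'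
      exact TraceClass.op_injective (norm_le_zero_iff.1 h')
    · rintro rfl
      simp [TraceClass.norm_def, TraceClass.op_zero, traceNorm_zero]

instance : NormedAddCommGroup (TraceClass H) := NormedAddCommGroup.ofCore traceClassCore

instance : NormedSpace ℂ (TraceClass H) := NormedSpace.ofCore traceClassCore

open Filter Topology in
instance : CompleteSpace (TraceClass H) := by
  refine Metric.complete_of_cauchySeq_tendsto fun u hu => ?_
  have hop : CauchySeq fun n => (u n).op := by
    rw [Metric.cauchySeq_iff] at hu ⊢
    intro ε hε
    obtain ⟨N, hN⟩ := hu ε hε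
    refine ⟨N, fun m hm n hn => lt_of_le_of_lt ?_ (hN m hm n hn)⟩
    rw [dist_eq_norm, dist_eq_norm, ← TraceClass.op_sub]
    exact TraceClass.norm_op_le _
  obtain ⟨T, hT⟩ := cauchySeq_tendsto_of_complete hop
  have key : ∀ ε > 0, ∃ N, ∀ n ≥ N, traceNorm (T - (u n).op) ≤ ENNReal.ofReal ε := by
    intro ε hε
    obtain ⟨N, hN⟩ := Metric.cauchySeq_iff.1 hu ε hε
    refine ⟨N, fun n hn => ?_⟩
    refine traceNorm_le_of_tendsto (hT.sub_const ((u n).op)) ?_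
    filter_upwards [eventually_ge_atTop N] with m hm
    have h := (hN m hm n hn).le
    rw [dist_eq_norm, TraceClass.norm_def] at h
    rw [← TraceClass.op_sub]
    exact (ENNReal.le_ofReal_iff_toReal_le (TraceClass.traceNorm_op_ne_top _) hε.le).2 h
  have hmem : traceNorm T ≠ ⊤ := by
    obtain ⟨N, hN⟩ := key 1 one_pos
    have h := traceNorm_add_le (T - (u N).op) (u N).op
    rw [sub_add_cancel] at h
    exact ne_top_of_le_ne_top (ENNReal.add_ne_top.2
      ⟨ne_top_of_le_ne_top ENNReal.ofReal_ne_top (hN N le_rfl), (u N).traceNorm_op_ne_top⟩) h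
  obtain ⟨T', hT'⟩ : ∃ T' : TraceClass H, T'.op = T := ⟨⟨T, hmem⟩, rfl⟩
  refine ⟨T', Metric.tendsto_atTop.2 fun ε hε => ?_⟩
  obtain ⟨N, hN⟩ := key (ε / 2) (half_pos hε)
  refine ⟨N, fun n hn => lt_of_le_of_lt ?_ (half_lt_self hε)⟩
  rw [dist_comm, dist_eq_norm, TraceClass.norm_def, TraceClass.op_sub, hT']
  exact ENNReal.toReal_le_of_le_ofReal (half_pos hε).le (hN n hn)

/-- The Borel sigma-algebra of the trace norm topology. -/
instance : MeasurableSpace (TraceClass H) := borel _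

instance : BorelSpace (TraceClass H) := ⟨rfl⟩

/-- The trace of a trace-class operator. -/
def TraceClass.trace (T : TraceClass H) : ℂ := ∑' i, inner ℂ (basis H i) (T.op (basis H i))

/-- A state (density operator): a positive trace-class operator of trace one. -/
def IsState (Γ : TraceClass H) : Prop := Γ.op.IsPositive ∧ Γ.trace = 1

variable (H) in
/-- The pure states `P_Ψ = |Ψ⟩⟨Ψ|`, `Ψ` a unit vector, as a subset of the trace class. It carries
the metric and the Borel sigma-algebra induced from the trace class. -/
def pureStates : Set (TraceClass H) :=
  {P | ∃ Ψ : H, ‖Ψ‖ = 1 ∧ P.op = InnerProductSpace.rankOne ℂ Ψ Ψ}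

/-- `Γ` is the barycenter `∫ P dμ(P)` of the Borel probability measure `μ` on the set of pure
states; the integral is the Bochner integral in the trace class. -/
def IsBarycenter (μ : ProbabilityMeasure (pureStates H)) (Γ : TraceClass H) : Prop :=
  Integrable (fun P : pureStates H => (P : TraceClass H)) (μ : Measure (pureStates H)) ∧
    ∫ P : pureStates H, (P : TraceClass H) ∂(μ : Measure (pureStates H)) = Γ

end TraceClass

section Bipartite

variable {A B : Type*} [NormedAddCommGroup A] [InnerProductSpace ℂ A]
  [NormedAddCommGroup B] [InnerProductSpace ℂ B]

/-- The Hilbert space tensor product: the completion of the algebraic tensor product with respect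
to the inner product with `⟪a ⊗ b, a' ⊗ b'⟫ = ⟪a, a'⟫ ⟪b, b'⟫`. -/
abbrev HilbertTensor (A B : Type*) [NormedAddCommGroup A] [InnerProductSpace ℂ A]
    [NormedAddCommGroup B] [InnerProductSpace ℂ B] : Type _ :=
  UniformSpace.Completion (A ⊗[ℂ] B)

/-- The product vector `a ⊗ b`. -/
def productVector (a : A) (b : B) : HilbertTensor A B := ((a ⊗ₜ[ℂ] b : A ⊗[ℂ] B) : HilbertTensor A B)

/-- The tensor product of two bounded operators: the bounded operator on the Hilbert space tensor
product which maps `a ⊗ b` to `S a ⊗ T b`. -/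
def tensorOp (S : A →L[ℂ] A) (T : B →L[ℂ] B) : HilbertTensor A B →L[ℂ] HilbertTensor A B :=
  (TensorProduct.mapL S T).completion

/-- `Ψ = ∑ c_i e_i ⊗ f_i` with exactly `n` Schmidt coefficients `c_i > 0` and orthonormal systems
`e_i`, `f_i`. -/
def HasSchmidtDecomposition (Ψ : HilbertTensor A B) (n : ℕ) : Prop :=
  ∃ (c : Fin n → ℝ) (e : Fin n → A) (f : Fin n → B), (∀ i, 0 < c i) ∧
    Orthonormal ℂ e ∧ Orthonormal ℂ f ∧ Ψ = ∑ i, (c i : ℂ) • productVector (e i) (f i)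

/-- The Schmidt rank: the number of nonzero Schmidt coefficients, `∞` if there is no finite
Schmidt decomposition. -/
def schmidtRank (Ψ : HilbertTensor A B) : ℕ∞ :=
  ⨅ (n : ℕ) (_ : HasSchmidtDecomposition Ψ n), (n : ℕ∞)

/-- The Schmidt rank `r_S(Ψ)` of a pure state `P_Ψ`; it does not depend on the choice of the unit
vector `Ψ`, see `pureSchmidtRank_eq`. -/
def pureSchmidtRank (P : pureStates (HilbertTensor A B)) : ℕ∞ :=
  schmidtRank P.2.choose

theorem HasSchmidtDecomposition.smul {Ψ : HilbertTensor A B} {n : ℕ}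
    (h : HasSchmidtDecomposition Ψ n) {z : ℂ} (hz : ‖z‖ = 1) :
    HasSchmidtDecomposition (z • Ψ) n := by
  obtain ⟨c, e, f, hc, he, hf, rfl⟩ := h
  refine ⟨c, fun i => z • e i, f, hc, ⟨fun i => ?_, fun i j hij => ?_⟩, hf, ?_⟩
  · rw [norm_smul, hz, he.1 i, one_mul]
  · simp [inner_smul_left, inner_smul_right, he.2 hij]
  · rw [Finset.smul_sum]
    refine Finset.sum_congr rfl fun i _ => ?_
    have h : productVector (z • e i) (f i) = z • productVector (e i) (f i) := by
      simp only [productVector]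
      rw [← UniformSpace.Completion.coe_smul, TensorProduct.smul_tmul']
    rw [h, smul_comm]

theorem schmidtRank_smul (Ψ : HilbertTensor A B) {z : ℂ} (hz : ‖z‖ = 1) :
    schmidtRank (z • Ψ) = schmidtRank Ψ := by
  have hz0 : z ≠ 0 := fun h => by simp [h] at hz
  refine iInf_congr fun n => iInf_congr_Prop ⟨fun h => ?_, fun h => h.smul hz⟩ fun _ => rfl
  simpa [hz0] using h.smul (z := z⁻¹) (by simp [hz])

/-- The Schmidt rank of a pure state can be computed from any of its unit vectors. -/
theorem pureSchmidtRank_eq (P : pureStates (HilbertTensor A B)) {Ψ : HilbertTensor A B}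
    (hΨ : ‖Ψ‖ = 1) (hP : P.1.op = InnerProductSpace.rankOne ℂ Ψ Ψ) :
    pureSchmidtRank P = schmidtRank Ψ := by
  obtain ⟨hΦ, hPΦ⟩ := P.2.choose_spec
  set Φ := P.2.choose with hdef
  have h1 : Φ = (inner ℂ Ψ Φ : ℂ) • Ψ := by
    have h := congrArg (fun S : HilbertTensor A B →L[ℂ] HilbertTensor A B => S Φ)
      (hPΦ.symm.trans hP)
    simpa [hΦ] using h
  have h2 : ‖(inner ℂ Ψ Φ : ℂ)‖ = 1 := by
    have h := congrArg norm h1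
    rw [norm_smul, hΦ, hΨ, mul_one] at h
    exact h.symm
  rw [pureSchmidtRank, ← hdef, h1, schmidtRank_smul Ψ h2]

/-- The Schmidt number of a state `Γ`: the infimum, over all Borel probability measures `μ` on the
set of pure states with barycenter `Γ`, of the `μ`-essential supremum of the Schmidt rank. -/
def schmidtNumber (Γ : TraceClass (HilbertTensor A B)) : ℕ∞ :=
  ⨅ (μ : ProbabilityMeasure (pureStates (HilbertTensor A B))) (_ : IsBarycenter μ Γ),
    essSup pureSchmidtRank (μ : Measure (pureStates (HilbertTensor A B)))

variable [CompleteSpace A] [CompleteSpace B]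

variable (A B) in
/-- The product states `γ_A ⊗ γ_B`, with states `γ_A` and `γ_B`. -/
def productStates : Set (TraceClass (HilbertTensor A B)) :=
  {Γ | ∃ (γA : TraceClass A) (γB : TraceClass B),
    IsState γA ∧ IsState γB ∧ Γ.op = tensorOp γA.op γB.op}

variable (A B) in
/-- The set of separable states: the trace norm closure of the convex hull of the product
states. -/
def separableStates : Set (TraceClass (HilbertTensor A B)) :=
  closure (convexHull ℝ (productStates A B))

/-- The state `Γ` is separable. -/
def IsSeparable (Γ : TraceClass (HilbertTensor A B)) : Prop := Γ ∈ separableStates A B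

/-- The state `Γ` is entangled, that is, not separable. -/
def IsEntangled (Γ : TraceClass (HilbertTensor A B)) : Prop := ¬ IsSeparable Γ

end Bipartite

end SchmidtNumber

end

/-!
# Separable states are the states of Schmidt number one

The Schmidt number is always at least one, and a Schmidt number is attained because `ℕ∞` is
well-ordered, so the theorem says that `Γ` is separable if and only if it is the barycenter of a
probability measure which is carried by the pure product states `P_{a ⊗ b}`. Both conditions refer
to the closed convex hull of the pure product states, which is the set of separable states
(`separableStates_eq`): with `R = γ_A^{1/2}` and `S = γ_B^{1/2}`, a product state is the convergent
convex combination `γ_A ⊗ γ_B = ∑ |R e_i ⊗ S f_j⟩⟨R e_i ⊗ S f_j|`.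

A barycenter of pure product states lies in their closed convex hull
(`isSeparable_of_schmidtNumber_le_one`). The converse
(`exists_isBarycenter_of_isSeparable`) is a compactness argument. The pure states do not form a
compact space in infinite dimensions, so product vectors `a ⊗ b` with `‖a‖, ‖b‖ ≤ 1` are used,
parametrized by the coordinates of `a` and `b` in the product topology, that is, by a compact space
`K`. Since `Γ` is in the closed convex hull of countably many pure product states, countably many
coordinates suffice and `K` is metrizable. The probability measures on `K` form a compact space
(`compactSpace_probabilityMeasure`), and each matrix element of `∫ |a ⊗ b⟩⟨a ⊗ b| dμ` depends
continuously on `μ`. The operators whose matrix arises from some `μ` therefore form a closed convex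
set which contains the pure product states in question, hence `Γ` (`exists_mixtureMatrix_eq`).

Finally no mass is lost: `∫ ‖a ⊗ b‖² dμ = Tr Γ = 1` with `‖a ⊗ b‖ ≤ 1` forces `‖a ⊗ b‖ = 1` almost
everywhere (`ae_norm_coordProduct_eq_one`), and the image of `μ` under `a ⊗ b ↦ P_{a ⊗ b}` is the
required measure. It is carried by the product states, which form a closed set
(`isClosed_setOf_pureProductStates`).
-/

namespace SchmidtNumber

/-! ### Rank-one operators as elements of the trace class -/

section RankOne

variable {H : Type*} [NormedAddCommGroup H] [InnerProductSpace ℂ H] [CompleteSpace H]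

theorem traceNorm_rankOne_le (x y : H) :
    traceNorm (InnerProductSpace.rankOne ℂ x y) ≤ ‖x‖ₑ * ‖y‖ₑ := by
  have unit : ∀ x y : H, ‖x‖ = 1 → ‖y‖ = 1 →
      traceNorm (InnerProductSpace.rankOne ℂ x y) ≤ 1 := by
    intro x y hx hy
    obtain ⟨V, hV, -, hVT⟩ := exists_polar (InnerProductSpace.rankOne ℂ x y)
    refine (traceNorm_le_of_polar hVT).trans ?_
    set z := ContinuousLinearMap.adjoint V x with hz
    have hz1 : ‖z‖ₑ ^ 2 ≤ 1 := by
      have h : ‖z‖ ≤ 1 := by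
        simpa [hx] using (ContinuousLinearMap.adjoint V).le_of_opNorm_le
          (norm_adjoint_le_one hV) x
      have h' : ‖z‖ₑ ≤ 1 := by
        rw [← ofReal_norm]; exact ENNReal.ofReal_le_one.2 h
      exact pow_le_one' h' 2
    have hy1 : ‖y‖ₑ ^ 2 = 1 := by rw [← ofReal_norm, hy]; simp
    -- arithmetic-geometric mean inequality, termwise in the orthonormal basis
    have h2 : ∀ i, 2 * ‖inner ℂ (basis H i) (ContinuousLinearMap.adjoint V
        (InnerProductSpace.rankOne ℂ x y (basis H i)))‖ₑ ≤
        ‖inner ℂ (basis H i) z‖ₑ ^ 2 + ‖inner ℂ (basis H i) y‖ₑ ^ 2 := by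
      intro i
      have e : inner ℂ (basis H i) (ContinuousLinearMap.adjoint V
        (InnerProductSpace.rankOne ℂ x y (basis H i))) =
          inner ℂ y (basis H i) * inner ℂ (basis H i) z := by
        simp [hz]
      have h : 2 * ‖inner ℂ (basis H i) z‖₊ * ‖inner ℂ (basis H i) y‖₊ ≤
        ‖inner ℂ (basis H i) z‖₊ ^ 2 + ‖inner ℂ (basis H i) y‖₊ ^ 2 := two_mul_le_add_sq _ _
      have h' : ‖inner ℂ y (basis H i)‖ₑ = ‖inner ℂ (basis H i) y‖ₑ := by
        rw [← inner_conj_symm, RCLike.enorm_conj]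
      rw [e, enorm_mul, h', mul_comm ‖inner ℂ (basis H i) y‖ₑ, ← mul_assoc]
      simp only [enorm_eq_nnnorm]
      exact_mod_cast h
    have h3 := ENNReal.tsum_le_tsum h2
    rw [ENNReal.tsum_mul_left, ENNReal.tsum_add, ← parseval, ← parseval, hy1] at h3
    have h4 := h3.trans (add_le_add_left hz1 1)
    rw [one_add_one_eq_two] at h4
    nth_rewrite 2 [← mul_one 2] at h4
    exact (ENNReal.mul_le_mul_iff_right two_ne_zero ENNReal.ofNat_ne_top).1 h4
  by_cases hx : x = 0
  · simp [hx, traceNorm_zero]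
  by_cases hy : y = 0
  · simp [hy, traceNorm_zero]
  have e : InnerProductSpace.rankOne ℂ x y = ((‖x‖ : ℂ) * ‖y‖) •
      InnerProductSpace.rankOne ℂ ((‖x‖⁻¹ : ℂ) • x) ((‖y‖⁻¹ : ℂ) • y) := by
    ext v
    have hx' : (‖x‖ : ℂ) ≠ 0 := by simpa using hx
    have hy' : (‖y‖ : ℂ) ≠ 0 := by simpa using hy
    simp only [InnerProductSpace.rankOne_apply, smul_apply, inner_smul_left, smul_smul,
      map_inv₀, Complex.conj_ofReal]
    congr 1
    field_simp
  rw [e, traceNorm_smul]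
  refine (mul_le_mul_right (unit _ _ ?_ ?_) _).trans ?_
  · simp [norm_smul, hx]
  · simp [norm_smul, hy]
  · simp [← ofReal_norm]

/-- The rank-one operator `|x⟩⟨y|` as an element of the trace class. -/
noncomputable def ketBra (x y : H) : TraceClass H :=
  ⟨InnerProductSpace.rankOne ℂ x y, ne_top_of_le_ne_top
    (ENNReal.mul_ne_top enorm_ne_top enorm_ne_top) (traceNorm_rankOne_le x y)⟩

@[simp]
theorem op_ketBra (x y : H) : (ketBra x y).op = InnerProductSpace.rankOne ℂ x y := rfl

theorem norm_ketBra_le (x y : H) : ‖ketBra x y‖ ≤ ‖x‖ * ‖y‖ := by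
  have h := ENNReal.toReal_mono (ENNReal.mul_ne_top enorm_ne_top enorm_ne_top)
    (traceNorm_rankOne_le x y)
  simpa [TraceClass.norm_def] using h

theorem continuous_ketBra_self : Continuous fun x : H => ketBra x x := by
  rw [continuous_iff_continuousAt]
  intro x
  rw [ContinuousAt, tendsto_iff_norm_sub_tendsto_zero]
  have e : ∀ y, ketBra y y - ketBra x x = ketBra (y - x) y + ketBra x (y - x) := by
    intro y
    apply TraceClass.op_injective
    simp [TraceClass.op_sub, TraceClass.op_add]
  have h : Filter.Tendsto (fun y : H => ‖y - x‖ * ‖y‖ + ‖x‖ * ‖y - x‖) (nhds x) (nhds 0) := by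
    have : Continuous fun y : H => ‖y - x‖ * ‖y‖ + ‖x‖ * ‖y - x‖ := by fun_prop
    simpa using this.tendsto x
  refine squeeze_zero (fun _ => norm_nonneg _) (fun y => ?_) h
  rw [e]
  exact (norm_add_le _ _).trans (add_le_add (norm_ketBra_le _ _) (norm_ketBra_le _ _))

/-- The matrix element `T ↦ ⟨u, T v⟩`, as a continuous linear functional on the trace class. -/
noncomputable def matrixElement (u v : H) : TraceClass H →L[ℂ] ℂ :=
  LinearMap.mkContinuous
    { toFun := fun T => inner ℂ u (T.op v)
      map_add' := fun S T => by simp [TraceClass.op_add]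
      map_smul' := fun c T => by simp [TraceClass.op_smul] }
    (‖u‖ * ‖v‖) fun T => by
      refine (norm_inner_le_norm _ _).trans ?_
      rw [mul_assoc]
      gcongr
      rw [mul_comm]
      exact (T.op.le_opNorm v).trans (by gcongr; exact T.norm_op_le)

@[simp]
theorem matrixElement_apply (u v : H) (T : TraceClass H) :
    matrixElement u v T = inner ℂ u (T.op v) := rfl

theorem ext_of_matrixElement {ι : Type*} (b : HilbertBasis ι ℂ H) {S T : TraceClass H}
    (h : ∀ p q, matrixElement (b p) (b q) S = matrixElement (b p) (b q) T) : S = T := by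
  apply TraceClass.op_injective
  refine ContinuousLinearMap.ext_on
    (Submodule.dense_iff_topologicalClosure_eq_top.2 b.dense_span) ?_
  rintro _ ⟨q, rfl⟩
  apply b.repr.injective
  ext p
  simpa [b.repr_apply_apply] using h p q

theorem ketBra_mem_pureStates {x : H} (hx : ‖x‖ = 1) : ketBra x x ∈ pureStates H :=
  ⟨x, hx, rfl⟩

theorem isState_ketBra {x : H} (hx : ‖x‖ = 1) : IsState (ketBra x x) := by
  refine ⟨by simp, ?_⟩
  have h := (basis H).tsum_inner_mul_inner x x
  rw [inner_self_eq_norm_sq_to_K, hx] at h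
  simpa [TraceClass.trace] using h

/-- For a state, the trace norm is the trace. -/
theorem IsState.traceNorm_eq_one {Γ : TraceClass H} (hΓ : IsState Γ) : traceNorm Γ.op = 1 := by
  have hpos := hΓ.1
  have habs : CFC.abs Γ.op = Γ.op :=
    CFC.abs_of_nonneg _ ((ContinuousLinearMap.nonneg_iff_isPositive _).2 hpos)
  have hsum : Summable fun i => inner ℂ (basis H i) (Γ.op (basis H i)) := by
    refine Summable.of_norm ?_
    have h := ne_top_of_le_ne_top Γ.traceNorm_op_ne_top
      (tsum_enorm_inner_le (basis H) (ContinuousLinearMap.id ℂ H) Γ.op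
        ContinuousLinearMap.norm_id_le)
    simpa using ENNReal.summable_toReal h
  have hre : HasSum (fun i => (inner ℂ (basis H i) (Γ.op (basis H i))).re) 1 := by
    have h := Complex.hasSum_re hsum.hasSum
    have h1 : ∑' i, inner ℂ (basis H i) (Γ.op (basis H i)) = 1 := hΓ.2
    rwa [h1, Complex.one_re] at h
  rw [traceNorm, habs]
  simp only [RCLike.re_to_complex]
  rw [← ENNReal.ofReal_tsum_of_nonneg (fun i => ?_) hre.summable, hre.tsum_eq, ENNReal.ofReal_one]
  simpa using hpos.re_inner_nonneg_right (basis H i)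

end RankOne

/-! ### Product vectors and the product basis -/

section ProductVector

variable {A B : Type*} [NormedAddCommGroup A] [InnerProductSpace ℂ A]
  [NormedAddCommGroup B] [InnerProductSpace ℂ B]

@[simp]
theorem inner_productVector (a a' : A) (b b' : B) :
    inner ℂ (productVector a b) (productVector a' b') = inner ℂ a a' * inner ℂ b b' := by
  simp [productVector]

@[simp]
theorem norm_productVector (a : A) (b : B) : ‖productVector a b‖ = ‖a‖ * ‖b‖ := by
  simp [productVector]

theorem continuous_productVector : Continuous fun x : A × B => productVector x.1 x.2 :=
  (UniformSpace.Completion.continuous_coe _).comp TensorProduct.continuous_tmul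

theorem productVector_smul_smul (s t : ℂ) (a : A) (b : B) :
    productVector (s • a) (t • b) = (s * t) • productVector a b := by
  simp only [productVector]
  rw [← UniformSpace.Completion.coe_smul, TensorProduct.smul_tmul_smul]

theorem productVector_smul_left (s : ℂ) (a : A) (b : B) :
    productVector (s • a) b = s • productVector a b := by
  simpa using productVector_smul_smul s 1 a b

@[simp]
theorem tensorOp_productVector (S : A →L[ℂ] A) (T : B →L[ℂ] B) (a : A) (b : B) :
    tensorOp S T (productVector a b) = productVector (S a) (T b) := by
  simp only [tensorOp, productVector]
  rw [ContinuousLinearMap.completion_apply_coe]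
  rfl

/-- The products of two families with dense linear spans have a dense linear span. -/
theorem span_productVector {ι κ : Type*} {e : ι → A} {f : κ → B}
    (he : (Submodule.span ℂ (Set.range e)).topologicalClosure = ⊤)
    (hf : (Submodule.span ℂ (Set.range f)).topologicalClosure = ⊤) :
    (Submodule.span ℂ (Set.range fun p : ι × κ => productVector (e p.1) (f p.2))).topologicalClosure
      = ⊤ := by
  set V := (Submodule.span ℂ
    (Set.range fun p : ι × κ => productVector (e p.1) (f p.2))).topologicalClosure with hV
  have hVc : IsClosed (V : Set (HilbertTensor A B)) := Submodule.isClosed_topologicalClosure _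
  let L : A →ₗ[ℂ] B →ₗ[ℂ] HilbertTensor A B :=
    (TensorProduct.mk ℂ A B).compr₂ (UniformSpace.Completion.toComplL (𝕜 := ℂ)).toLinearMap
  have hL : ∀ a b, L a b = productVector a b := fun a b => rfl
  have h1 : ∀ i b, productVector (e i) b ∈ V := by
    intro i b
    have hle : Submodule.span ℂ (Set.range f) ≤ V.comap (L (e i)) := by
      rw [Submodule.span_le]
      rintro _ ⟨j, rfl⟩
      exact Submodule.le_topologicalClosure _ (Submodule.subset_span ⟨(i, j), rfl⟩)
    have hcl : IsClosed {b : B | productVector (e i) b ∈ V} :=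
      hVc.preimage (continuous_productVector.comp (by fun_prop : Continuous fun b : B => (e i, b)))
    have hb : b ∈ closure ((Submodule.span ℂ (Set.range f) : Submodule ℂ B) : Set B) := by
      rw [← Submodule.topologicalClosure_coe, hf]; trivial
    exact closure_minimal (fun y hy => hle hy) hcl hb
  have h2 : ∀ a b, productVector a b ∈ V := by
    intro a b
    have hle : Submodule.span ℂ (Set.range e) ≤ V.comap (L.flip b) := by
      rw [Submodule.span_le]
      rintro _ ⟨i, rfl⟩
      exact h1 i b
    have hcl : IsClosed {a : A | productVector a b ∈ V} :=
      hVc.preimage (continuous_productVector.comp (by fun_prop : Continuous fun a : A => (a, b)))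
    have ha : a ∈ closure ((Submodule.span ℂ (Set.range e) : Submodule ℂ A) : Set A) := by
      rw [← Submodule.topologicalClosure_coe, he]; trivial
    exact closure_minimal (fun y hy => hle hy) hcl ha
  rw [eq_top_iff]
  intro x _
  refine UniformSpace.Completion.induction_on (p := fun x => x ∈ V) x hVc fun t => ?_
  induction t using TensorProduct.induction_on with
  | zero => exact V.zero_mem
  | tmul a b => exact h2 a b
  | add s t hs ht => rw [UniformSpace.Completion.coe_add]; exact V.add_mem hs ht

/-- The orthonormal basis `e_i ⊗ f_j` of the Hilbert space tensor product. -/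
noncomputable def productBasis {ι κ : Type*} (e : HilbertBasis ι ℂ A) (f : HilbertBasis κ ℂ B) :
    HilbertBasis (ι × κ) ℂ (HilbertTensor A B) :=
  HilbertBasis.mk (v := fun p : ι × κ => productVector (e p.1) (f p.2))
    (by
      classical
      rw [orthonormal_iff_ite]
      rintro ⟨i, j⟩ ⟨k, l⟩
      rw [inner_productVector, orthonormal_iff_ite.1 e.orthonormal,
        orthonormal_iff_ite.1 f.orthonormal]
      by_cases h1 : i = k <;> by_cases h2 : j = l <;> simp [h1, h2])
    (span_productVector e.dense_span f.dense_span).ge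

@[simp]
theorem productBasis_apply {ι κ : Type*} (e : HilbertBasis ι ℂ A) (f : HilbertBasis κ ℂ B)
    (p : ι × κ) : productBasis e f p = productVector (e p.1) (f p.2) := by
  simp [productBasis]

theorem hilbertBasis_ext {H ι : Type*} [NormedAddCommGroup H] [InnerProductSpace ℂ H]
    (b : HilbertBasis ι ℂ H) {x y : H} (h : ∀ i, inner ℂ (b i) x = inner ℂ (b i) y) : x = y := by
  apply b.repr.injective
  ext i
  simpa [b.repr_apply_apply] using h i

/-- A vector all of whose `2 × 2` minors vanish in a product basis is a product vector. -/
theorem exists_eq_productVector {ι κ : Type*} (e : HilbertBasis ι ℂ A) (f : HilbertBasis κ ℂ B)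
    (Ψ : HilbertTensor A B)
    (h : ∀ i j k l, inner ℂ (productBasis e f (i, j)) Ψ * inner ℂ (productBasis e f (k, l)) Ψ =
      inner ℂ (productBasis e f (i, l)) Ψ * inner ℂ (productBasis e f (k, j)) Ψ) :
    ∃ a b, Ψ = productVector a b := by
  by_cases h0 : ∀ p, inner ℂ (productBasis e f p) Ψ = 0
  · refine ⟨0, 0, hilbertBasis_ext (productBasis e f) fun p => ?_⟩
    rw [h0]; simp
  push Not at h0
  obtain ⟨⟨k, l⟩, hkl⟩ := h0
  have hs : Summable fun p => ‖inner ℂ (productBasis e f p) Ψ‖ ^ 2 :=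
    (productBasis e f).orthonormal.inner_products_summable Ψ
  -- the column `l` and the row `k` of the coefficient matrix
  have hA : Memℓp (fun i => inner ℂ (productBasis e f (i, l)) Ψ) 2 := by
    refine memℓp_gen ?_
    simpa [Function.comp_def] using hs.comp_injective (i := fun i => (i, l)) fun _ _ h => (Prod.ext_iff.1 h).1
  have hB : Memℓp (fun j => inner ℂ (productBasis e f (k, j)) Ψ) 2 := by
    refine memℓp_gen ?_
    simpa [Function.comp_def] using hs.comp_injective (i := fun j => (k, j)) fun _ _ h => (Prod.ext_iff.1 h).2
  set a := e.repr.symm ⟨_, hA⟩ with ha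
  set b := f.repr.symm ⟨_, hB⟩ with hb
  have ha' : ∀ i, inner ℂ (e i) a = inner ℂ (productBasis e f (i, l)) Ψ := by
    intro i; rw [← e.repr_apply_apply, ha, LinearIsometryEquiv.apply_symm_apply]
  have hb' : ∀ j, inner ℂ (f j) b = inner ℂ (productBasis e f (k, j)) Ψ := by
    intro j; rw [← f.repr_apply_apply, hb, LinearIsometryEquiv.apply_symm_apply]
  refine ⟨(inner ℂ (productBasis e f (k, l)) Ψ)⁻¹ • a, b,
    hilbertBasis_ext (productBasis e f) ?_⟩
  rintro ⟨i, j⟩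
  rw [productVector_smul_left, inner_smul_right, productBasis_apply e f (i, j),
    inner_productVector, ha', hb', ← h i j k l, ← productBasis_apply e f (i, j)]
  rw [mul_comm (inner ℂ (productBasis e f (i, j)) Ψ), inv_mul_cancel_left₀ hkl]

end ProductVector

/-! ### Pure product states -/

section PureProduct

variable {A B : Type*} [NormedAddCommGroup A] [InnerProductSpace ℂ A]
  [NormedAddCommGroup B] [InnerProductSpace ℂ B]

theorem one_le_schmidtRank {Ψ : HilbertTensor A B} (hΨ : ‖Ψ‖ = 1) : 1 ≤ schmidtRank Ψ := by
  refine le_iInf₂ fun n hn => ?_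
  rcases Nat.eq_zero_or_pos n with rfl | h
  · obtain ⟨c, e, f, -, -, -, rfl⟩ := hn
    simp at hΨ
  · exact_mod_cast h

/-- The unit vectors of Schmidt rank at most one are the products of unit vectors. -/
theorem schmidtRank_le_one_iff {Ψ : HilbertTensor A B} (hΨ : ‖Ψ‖ = 1) :
    schmidtRank Ψ ≤ 1 ↔ ∃ a b, ‖a‖ = 1 ∧ ‖b‖ = 1 ∧ Ψ = productVector a b := by
  constructor
  · intro h
    have h2 : schmidtRank Ψ < 2 := lt_of_le_of_lt h (by norm_num)
    obtain ⟨n, hn⟩ := iInf_lt_iff.1 h2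
    obtain ⟨hd, hlt⟩ := iInf_lt_iff.1 hn
    clear hn
    obtain ⟨c, e, f, hc, he, hf, rfl⟩ := hd
    have hn' : n < 2 := by exact_mod_cast hlt
    interval_cases n
    · simp at hΨ
    · refine ⟨e 0, f 0, he.1 0, hf.1 0, ?_⟩
      simp only [Finset.univ_unique, Fin.default_eq_zero, Finset.sum_singleton, norm_smul,
        norm_productVector, he.1, hf.1, mul_one, Complex.norm_real, Real.norm_eq_abs,
        abs_of_pos (hc 0)] at hΨ ⊢
      rw [hΨ]; simp
  · rintro ⟨a, b, ha, hb, rfl⟩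
    refine iInf₂_le 1 ⟨fun _ => 1, fun _ => a, fun _ => b, fun _ => one_pos, ?_, ?_, by simp⟩
    · exact ⟨fun _ => ha, fun i j hij => (hij (Subsingleton.elim _ _)).elim⟩
    · exact ⟨fun _ => hb, fun i j hij => (hij (Subsingleton.elim _ _)).elim⟩

variable (A B) in
/-- The pure product states `P_{a ⊗ b}`, with unit vectors `a` and `b`. -/
def pureProductStates : Set (TraceClass (HilbertTensor A B)) :=
  {P | ∃ a b, ‖a‖ = 1 ∧ ‖b‖ = 1 ∧ P = ketBra (productVector a b) (productVector a b)}

theorem ketBra_mem_pureProductStates {a : A} {b : B} (h : ‖productVector a b‖ = 1) :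
    ketBra (productVector a b) (productVector a b) ∈ pureProductStates A B := by
  rw [norm_productVector] at h
  have ha : ‖a‖ ≠ 0 := fun h0 => by simp [h0] at h
  have ha' : (‖a‖ : ℂ) ≠ 0 := by exact_mod_cast ha
  refine ⟨(‖a‖⁻¹ : ℂ) • a, (‖a‖ : ℂ) • b, ?_, ?_, ?_⟩
  · simp [norm_smul, ha]
  · simp [norm_smul, h]
  · rw [productVector_smul_smul, inv_mul_cancel₀ ha', one_smul]

theorem one_le_pureSchmidtRank (P : pureStates (HilbertTensor A B)) : 1 ≤ pureSchmidtRank P :=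
  one_le_schmidtRank P.2.choose_spec.1

theorem pureSchmidtRank_le_one_iff (P : pureStates (HilbertTensor A B)) :
    pureSchmidtRank P ≤ 1 ↔ (P : TraceClass (HilbertTensor A B)) ∈ pureProductStates A B := by
  constructor
  · intro h
    obtain ⟨a, b, ha, hb, h⟩ := (schmidtRank_le_one_iff P.2.choose_spec.1).1 h
    refine ⟨a, b, ha, hb, TraceClass.op_injective ?_⟩
    rw [op_ketBra, ← h]
    exact P.2.choose_spec.2
  · rintro ⟨a, b, ha, hb, h⟩
    have h1 : ‖productVector a b‖ = 1 := by simp [ha, hb]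
    rw [pureSchmidtRank_eq P h1 (by rw [h, op_ketBra]), schmidtRank_le_one_iff h1]
    exact ⟨a, b, ha, hb, rfl⟩

variable [CompleteSpace A] [CompleteSpace B]

/-- The set of pure product states is closed, because being a product is the vanishing of the
`2 × 2` minors of the coefficient matrix. -/
theorem isClosed_setOf_pureProductStates :
    IsClosed {P : pureStates (HilbertTensor A B) |
      (P : TraceClass (HilbertTensor A B)) ∈ pureProductStates A B} := by
  set u := productBasis (basis A) (basis B) with hu
  have key : {P : pureStates (HilbertTensor A B) |
      (P : TraceClass (HilbertTensor A B)) ∈ pureProductStates A B} =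
      {P | ∀ i j k l r, matrixElement (u (i, j)) (u r) P.1 * matrixElement (u (k, l)) (u r) P.1 =
        matrixElement (u (i, l)) (u r) P.1 * matrixElement (u (k, j)) (u r) P.1} := by
    ext ⟨P, Ψ, hΨ, hP⟩
    simp only [Set.mem_ofPred_eq, matrixElement_apply, hP, InnerProductSpace.rankOne_apply,
      inner_smul_right]
    constructor
    · rintro ⟨a, b, ha, hb, rfl⟩ i j k l r
      rw [op_ketBra] at hP
      simp only [← inner_smul_right, ← InnerProductSpace.rankOne_apply (𝕜 := ℂ) Ψ Ψ, ← hP]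
      simp only [InnerProductSpace.rankOne_apply, inner_smul_right, hu, productBasis_apply,
        inner_productVector]
      ring
    · intro h
      have hr : ∃ r, inner ℂ Ψ (u r) ≠ 0 := by
        by_contra! hr
        have : Ψ = 0 := hilbertBasis_ext u fun i => by
          rw [← inner_conj_symm, hr, inner_zero_right, map_zero]
        simp [this] at hΨ
      obtain ⟨r, hr⟩ := hr
      obtain ⟨a, b, hab⟩ := exists_eq_productVector (basis A) (basis B) Ψ fun i j k l => by
        have := h i j k l r
        refine mul_left_cancel₀ (mul_ne_zero hr hr) ?_
        linear_combination this
      have hP' : P = ketBra (productVector a b) (productVector a b) :=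
        TraceClass.op_injective (by rw [hP, op_ketBra, hab])
      rw [hP']
      exact ketBra_mem_pureProductStates (hab ▸ hΨ)
  rw [key]
  simp only [Set.ofPred_forall]
  refine isClosed_iInter fun i => isClosed_iInter fun j => isClosed_iInter fun k =>
    isClosed_iInter fun l => isClosed_iInter fun r => isClosed_eq ?_ ?_
  · exact (((matrixElement _ _).continuous.comp continuous_subtype_val).mul
      ((matrixElement _ _).continuous.comp continuous_subtype_val))
  · exact (((matrixElement _ _).continuous.comp continuous_subtype_val).mul
      ((matrixElement _ _).continuous.comp continuous_subtype_val))

theorem pureProductStates_subset_productStates : pureProductStates A B ⊆ productStates A B := by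
  rintro _ ⟨a, b, ha, hb, rfl⟩
  refine ⟨ketBra a a, ketBra b b, isState_ketBra ha, isState_ketBra hb, ?_⟩
  refine ContinuousLinearMap.ext_on (Submodule.dense_iff_topologicalClosure_eq_top.2
    (productBasis (basis A) (basis B)).dense_span) ?_
  rintro _ ⟨p, rfl⟩
  simp [productVector_smul_smul]

/-- A convergent infinite convex combination of points of a closed convex set stays in it. -/
theorem convex_hasSum_mem {E ι : Type*} [AddCommGroup E] [Module ℝ E] [TopologicalSpace E]
    [ContinuousSMul ℝ E] {s : Set E} (hs : Convex ℝ s) (hc : IsClosed s)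
    {w : ι → ℝ} {z : ι → E} {x : E} (hw : ∀ i, 0 ≤ w i) (hw1 : HasSum w 1)
    (hz : ∀ i, w i ≠ 0 → z i ∈ s) (hx : HasSum (fun i => w i • z i) x) : x ∈ s := by
  classical
  have hlim : Filter.Tendsto (fun F : Finset ι => F.centerMass w z) Filter.atTop (nhds x) := by
    have h := (hw1.inv₀ one_ne_zero).smul hx
    simpa [Finset.centerMass] using h
  refine hc.mem_of_tendsto hlim ?_
  filter_upwards [hw1.eventually_const_lt one_pos] with F hF
  rw [← Finset.centerMass_filter_ne_zero]
  refine hs.centerMass_mem (fun i _ => hw i) ?_ fun i hi => hz i (Finset.mem_filter.1 hi).2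
  rwa [Finset.sum_filter_ne_zero]

theorem ketBra_smul_self {H : Type*} [NormedAddCommGroup H] [InnerProductSpace ℂ H]
    [CompleteSpace H] (c : ℂ) (x : H) :
    ketBra (c • x) (c • x) = (‖c‖ ^ 2) • ketBra x x := by
  have e : (‖c‖ ^ 2) • ketBra x x = ((‖c‖ : ℂ) ^ 2) • ketBra x x := by
    rw [← Complex.ofReal_pow]; exact (Complex.coe_smul _ _).symm
  rw [e, ← Complex.conj_mul']
  apply TraceClass.op_injective
  ext v
  simp [TraceClass.op_smul, smul_smul]
  ring_nf

theorem hasSum_norm_sq_absSqrt {H : Type*} [NormedAddCommGroup H] [InnerProductSpace ℂ H]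
    [CompleteSpace H] {γ : TraceClass H} (hγ : IsState γ) :
    HasSum (fun i => ‖absSqrt γ.op (basis H i)‖ ^ 2) 1 := by
  have h : ∑' i, ‖absSqrt γ.op (basis H i)‖ₑ ^ 2 = 1 := by
    rw [← hγ.traceNorm_eq_one, traceNorm_eq_hsSum (basis H)]; rfl
  have hs := ENNReal.hasSum_toReal (by rw [h]; exact ENNReal.one_ne_top)
  rw [← ENNReal.tsum_toReal_eq (fun i => by finiteness), h] at hs
  simpa using hs

/-- With `R = γ^{1/2}` and an orthonormal basis `e_i`, `γ = ∑ |R e_i⟩⟨R e_i|`. -/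
theorem hasSum_absSqrt {H : Type*} [NormedAddCommGroup H] [InnerProductSpace ℂ H]
    [CompleteSpace H] {γ : TraceClass H} (hγ : IsState γ) (x y : H) :
    HasSum (fun i => inner ℂ x (absSqrt γ.op (basis H i)) *
      inner ℂ (absSqrt γ.op (basis H i)) y) (inner ℂ x (γ.op y)) := by
  have h := (basis H).hasSum_inner_mul_inner (absSqrt γ.op x) (absSqrt γ.op y)
  have e : inner ℂ (absSqrt γ.op x) (absSqrt γ.op y) = inner ℂ x (γ.op y) := by
    nth_rewrite 1 [← adjoint_absSqrt]
    rw [ContinuousLinearMap.adjoint_inner_left, ← ContinuousLinearMap.comp_apply, absSqrt_comp,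
      CFC.abs_of_nonneg _ ((ContinuousLinearMap.nonneg_iff_isPositive _).2 hγ.1)]
  rw [e] at h
  have e' : ∀ i, inner ℂ x (absSqrt γ.op (basis H i)) * inner ℂ (absSqrt γ.op (basis H i)) y =
      inner ℂ (absSqrt γ.op x) (basis H i) * inner ℂ (basis H i) (absSqrt γ.op y) := by
    intro i
    rw [← ContinuousLinearMap.adjoint_inner_right, adjoint_absSqrt,
      ← ContinuousLinearMap.adjoint_inner_left, adjoint_absSqrt]
  simp_rw [e']
  exact h

theorem hasSum_mul_prod {ι κ : Type*} {f : ι → ℂ} {g : κ → ℂ} {s t : ℂ} (hf : HasSum f s)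
    (hg : HasSum g t) (h : Summable fun p : ι × κ => f p.1 * g p.2) :
    HasSum (fun p : ι × κ => f p.1 * g p.2) (s * t) :=
  hf.mul hg h

/-- With `R = γ_A^{1/2}` and `S = γ_B^{1/2}`, a product state is the infinite convex combination
`γ_A ⊗ γ_B = ∑ |R e_i ⊗ S f_j⟩⟨R e_i ⊗ S f_j|` of pure product states, up to normalization. -/
theorem productStates_subset_closure :
    productStates A B ⊆ closure (convexHull ℝ (pureProductStates A B)) := by
  rintro Γ ⟨γA, γB, hA, hB, hΓ⟩
  let x : basisIndex A → A := fun i => absSqrt γA.op (basis A i)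
  let y : basisIndex B → B := fun j => absSqrt γB.op (basis B j)
  let Ψ : basisIndex A × basisIndex B → HilbertTensor A B := fun p =>
    productVector (x p.1) (y p.2)
  have hΨ : ∀ p, Ψ p = productVector (x p.1) (y p.2) := fun _ => rfl
  have hw : HasSum (fun p => ‖Ψ p‖ ^ 2) 1 := by
    have hAs := hasSum_norm_sq_absSqrt hA
    have hBs := hasSum_norm_sq_absSqrt hB
    have h := hAs.mul hBs (hAs.summable.mul_of_nonneg hBs.summable
      (fun _ => by positivity) fun _ => by positivity)
    simpa [hΨ, mul_pow] using h
  have hs : Summable fun p => ketBra (Ψ p) (Ψ p) := by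
    refine Summable.of_norm_bounded hw.summable fun p => ?_
    rw [sq]; exact norm_ketBra_le _ _
  have hsum : ∑' p, ketBra (Ψ p) (Ψ p) = Γ := by
    refine ext_of_matrixElement (productBasis (basis A) (basis B)) fun p q => ?_
    have h1 := hs.hasSum.mapL (matrixElement (productBasis (basis A) (basis B) p)
      (productBasis (basis A) (basis B) q))
    have term : ∀ r, matrixElement (productBasis (basis A) (basis B) p)
        (productBasis (basis A) (basis B) q) (ketBra (Ψ r) (Ψ r)) =
        (inner ℂ (basis A p.1) (x r.1) * inner ℂ (x r.1) (basis A q.1)) *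
          (inner ℂ (basis B p.2) (y r.2) * inner ℂ (y r.2) (basis B q.2)) := by
      intro r
      rw [matrixElement_apply, op_ketBra, InnerProductSpace.rankOne_apply, inner_smul_right,
        productBasis_apply, productBasis_apply, hΨ, inner_productVector, inner_productVector]
      ring
    simp_rw [term] at h1
    refine h1.unique ?_
    rw [matrixElement_apply, hΓ, productBasis_apply, productBasis_apply, tensorOp_productVector,
      inner_productVector]
    exact hasSum_mul_prod (f := fun i => inner ℂ (basis A p.1) (x i) * inner ℂ (x i) (basis A q.1))
      (g := fun j => inner ℂ (basis B p.2) (y j) * inner ℂ (y j) (basis B q.2))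
      (hasSum_absSqrt hA (basis A p.1) (basis A q.1))
      (hasSum_absSqrt hB (basis B p.2) (basis B q.2)) h1.summable
  refine convex_hasSum_mem (convex_convexHull ℝ _).closure isClosed_closure
    (w := fun p => ‖Ψ p‖ ^ 2)
    (z := fun p => ketBra ((‖Ψ p‖ : ℂ)⁻¹ • Ψ p) ((‖Ψ p‖ : ℂ)⁻¹ • Ψ p))
    (fun p => by positivity) hw ?_ ?_
  · intro p hp
    have hp' : ‖x p.1‖ * ‖y p.2‖ ≠ 0 := by
      rw [← norm_productVector]; exact fun h => hp (by simp [hΨ, h])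
    obtain ⟨hx0, hy0⟩ := mul_ne_zero_iff.1 hp'
    refine subset_closure (subset_convexHull ℝ _
      ⟨(‖x p.1‖⁻¹ : ℂ) • x p.1, (‖y p.2‖⁻¹ : ℂ) • y p.2, ?_, ?_, ?_⟩)
    · simp [norm_smul, hx0]
    · simp [norm_smul, hy0]
    · rw [productVector_smul_smul]
      simp [hΨ, mul_comm]
  · convert hs.hasSum using 2 with p
    · rw [ketBra_smul_self, smul_smul]
      by_cases h : ‖Ψ p‖ = 0
      · have : ketBra (0 : HilbertTensor A B) 0 = 0 := TraceClass.op_injective (by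
          simp [TraceClass.op_zero])
        rw [norm_eq_zero.1 h, this, smul_zero]
      · rw [← mul_pow, norm_inv, Complex.norm_real, norm_norm, mul_inv_cancel₀ h, one_pow, one_smul]
    · exact hsum.symm

theorem separableStates_eq :
    separableStates A B = closure (convexHull ℝ (pureProductStates A B)) := by
  refine (closure_mono (convexHull_mono pureProductStates_subset_productStates)).antisymm' ?_
  exact closure_minimal (convexHull_min productStates_subset_closure
    (convex_convexHull ℝ _).closure) isClosed_closure

end PureProduct

/-! ### Compactness of the space of probability measures -/

section Compactness

open Filter Topology

variable {X : Type*} [TopologicalSpace X] [CompactSpace X] [T2Space X] [MeasurableSpace X]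
  [BorelSpace X]

/-- The probability measures on a compact Hausdorff space form a compact space in the topology of
weak convergence: along an ultrafilter the integrals of each continuous function converge, and the
limit is a positive functional, hence an integral by the Riesz-Markov-Kakutani theorem. -/
theorem compactSpace_probabilityMeasure : CompactSpace (ProbabilityMeasure X) := by
  refine ⟨isCompact_iff_ultrafilter_le_nhds.2 fun U _ => ?_⟩
  have hint : ∀ (ν : ProbabilityMeasure X) (f : C(X, ℝ)), Integrable f (ν : Measure X) :=
    fun ν f => (BoundedContinuousFunction.mkOfCompact f).integrable _
  have hlim : ∀ f : C(X, ℝ), ∃ l : ℝ,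
      Tendsto (fun ν : ProbabilityMeasure X => ∫ x, f x ∂(ν : Measure X)) U (𝓝 l) := by
    intro f
    have hK : IsCompact (Metric.closedBall (0 : ℝ) ‖f‖) := isCompact_closedBall _ _
    have hle : ∀ ν : ProbabilityMeasure X,
        ∫ x, f x ∂(ν : Measure X) ∈ Metric.closedBall (0 : ℝ) ‖f‖ := by
      intro ν
      rw [mem_closedBall_zero_iff]
      simpa using norm_integral_le_of_norm_le_const (μ := (ν : Measure X))
        (ae_of_all _ fun x => f.norm_coe_le_norm x)
    obtain ⟨l, -, hl⟩ := isCompact_iff_ultrafilter_le_nhds.1 hK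
      (U.map fun ν : ProbabilityMeasure X => ∫ x, f x ∂(ν : Measure X))
      (by
        rw [le_principal_iff]
        exact Ultrafilter.mem_coe.2 (Ultrafilter.mem_map.2 (Ultrafilter.mem_coe.1 (Filter.univ_mem' hle))))
    exact ⟨l, hl⟩
  choose L hL using hlim
  let Λ : CompactlySupportedContinuousMap X ℝ →ₚ[ℝ] ℝ := PositiveLinearMap.mk₀
    { toFun := fun f => L f.toContinuousMap
      map_add' := fun f g => by
        refine tendsto_nhds_unique (hL _) (((hL f.toContinuousMap).add
          (hL g.toContinuousMap)).congr fun ν => ?_)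
        exact (integral_add (hint ν _) (hint ν _)).symm
      map_smul' := fun c f => by
        refine tendsto_nhds_unique (hL _) (((hL f.toContinuousMap).const_mul c).congr fun ν => ?_)
        exact (integral_const_mul c _).symm }
    (fun f hf => ge_of_tendsto' (hL f.toContinuousMap) fun ν => integral_nonneg fun x => hf x)
  let toC (f : C(X, ℝ)) : CompactlySupportedContinuousMap X ℝ :=
    ⟨f, HasCompactSupport.of_compactSpace f⟩
  have hΛ : ∀ f : C(X, ℝ), ∫ x, f x ∂(RealRMK.rieszMeasure Λ) = L f :=
    fun f => RealRMK.integral_rieszMeasure Λ (toC f)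
  have hprob : IsProbabilityMeasure (RealRMK.rieszMeasure Λ) := by
    have h1 : L 1 = 1 := by
      refine tendsto_nhds_unique (hL 1) (tendsto_const_nhds.congr fun ν => ?_)
      simp
    have h := hΛ 1
    rw [h1] at h
    have h2 : (RealRMK.rieszMeasure Λ).real Set.univ = 1 := by simpa using h
    exact ⟨by rw [← ENNReal.ofReal_one, ← h2, ofReal_measureReal]⟩
  refine ⟨⟨RealRMK.rieszMeasure Λ, hprob⟩, Set.mem_univ _, ?_⟩
  have ht := (ProbabilityMeasure.tendsto_iff_forall_integral_tendsto (F := (U : Filter _))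
    (μs := id) (μ := ⟨RealRMK.rieszMeasure Λ, hprob⟩)).2 fun f => by
      have h := hL f.toContinuousMap
      rw [← hΛ] at h
      exact h
  exact ht

end Compactness

/-! ### Coordinates in the unit ball of a Hilbert space -/

section Coordinates

open Filter Topology

/-- The unit ball of `ℓ²(ι)` as a set of families of coordinates. In the product topology, which
on this set is the weak topology of `ℓ²(ι)`, it is compact. -/
def coordBall (ι : Type*) : Set (ι → ℂ) := {x | ∀ F : Finset ι, ∑ i ∈ F, ‖x i‖ ^ 2 ≤ 1}

theorem isCompact_coordBall (ι : Type*) : IsCompact (coordBall ι) := by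
  have hc : IsClosed (coordBall ι) := by
    simp only [coordBall, Set.ofPred_forall]
    exact isClosed_iInter fun F => isClosed_le (by fun_prop) continuous_const
  refine (isCompact_univ_pi fun _ : ι => isCompact_closedBall (0 : ℂ) 1).of_isClosed_subset hc ?_
  intro x hx i _
  have h := hx {i}
  rw [Finset.sum_singleton] at h
  rw [mem_closedBall_zero_iff]
  exact (sq_le_one_iff₀ (norm_nonneg _)).1 h

instance (ι : Type*) : CompactSpace (coordBall ι) :=
  isCompact_iff_compactSpace.1 (isCompact_coordBall ι)

variable {H I : Type*} [NormedAddCommGroup H] [InnerProductSpace ℂ H] [CompleteSpace H]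

/-- The vector with coordinates `x` with respect to the part of an orthonormal basis which is
indexed by `s`. -/
noncomputable def coordVec (b : HilbertBasis I ℂ H) (s : Set I) (x : coordBall s) : H :=
  ∑' i, x.1 i • b i

variable (b : HilbertBasis I ℂ H) (s : Set I)

theorem hasSum_coordVec (x : coordBall s) : HasSum (fun i => x.1 i • b i) (coordVec b s x) := by
  have ho : Orthonormal ℂ fun i : s => b i := b.orthonormal.comp _ Subtype.val_injective
  have hs : Summable fun i : s => ‖x.1 i‖ ^ 2 :=
    summable_of_sum_le (fun _ => by positivity) x.2
  exact ((ho.orthogonalFamily.summable_iff_norm_sq_summable x.1).2 hs).hasSum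

open Classical in
theorem inner_coordVec (k : I) (x : coordBall s) :
    inner ℂ (b k) (coordVec b s x) = if h : k ∈ s then x.1 ⟨k, h⟩ else 0 := by
  have h1 := (hasSum_coordVec b s x).mapL (innerSL ℂ (b k))
  refine h1.unique ?_
  have e : ∀ i : s, innerSL ℂ (b k) (x.1 i • b i) = if (i : I) = k then x.1 i else 0 := by
    intro i
    rw [innerSL_apply_apply, inner_smul_right, orthonormal_iff_ite.1 b.orthonormal]
    by_cases h : (i : I) = k
    · simp [h]
    · simp [h, Ne.symm h]
  simp_rw [e]
  split_ifs with h
  · have e' : ∀ i : s, (if (i : I) = k then x.1 i else 0) =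
        if i = ⟨k, h⟩ then x.1 ⟨k, h⟩ else 0 := by
      intro i
      by_cases hi : (i : I) = k
      · have hi' : i = ⟨k, h⟩ := Subtype.ext hi
        simp [hi']
      · have hi' : i ≠ ⟨k, h⟩ := fun h => hi (congrArg Subtype.val h)
        simp [hi', hi]
    simp_rw [e']
    exact hasSum_ite_eq _ _
  · convert hasSum_zero using 2 with i
    rw [if_neg]
    rintro rfl
    exact h i.2

theorem inner_coordVec_of_notMem {k : I} (hk : k ∉ s) (x : coordBall s) :
    inner ℂ (b k) (coordVec b s x) = 0 := by
  rw [inner_coordVec, dif_neg hk]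

theorem continuous_inner_coordVec (k : I) :
    Continuous fun x : coordBall s => inner ℂ (b k) (coordVec b s x) := by
  simp_rw [inner_coordVec]
  split_ifs with h
  · exact (continuous_apply _).comp continuous_subtype_val
  · exact continuous_const

theorem norm_coordVec_le (x : coordBall s) : ‖coordVec b s x‖ ≤ 1 := by
  refine le_of_tendsto (hasSum_coordVec b s x).norm (Eventually.of_forall fun F => ?_)
  have ho : Orthonormal ℂ fun i : s => b i := b.orthonormal.comp _ Subtype.val_injective
  have h := ho.inner_sum x.1 x.1 F
  rw [← sq_le_one_iff₀ (norm_nonneg _), ← inner_self_eq_norm_sq (𝕜 := ℂ), h]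
  refine le_trans (le_of_eq ?_) (x.2 F)
  simp only [Complex.conj_mul', ← Complex.ofReal_pow, ← Complex.ofReal_sum]
  exact Complex.ofReal_re _

/-- A unit vector whose coefficients vanish outside `s` is in the range of `coordVec`. -/
theorem exists_coordVec_eq {a : H} (ha : ‖a‖ = 1) (hs : ∀ i, inner ℂ (b i) a ≠ 0 → i ∈ s) :
    ∃ x, coordVec b s x = a := by
  have ho : Orthonormal ℂ fun i : s => b i := b.orthonormal.comp _ Subtype.val_injective
  refine ⟨⟨fun i => inner ℂ (b i) a, fun F => ?_⟩, hilbertBasis_ext b fun k => ?_⟩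
  · simpa [ha] using ho.sum_inner_products_le a (s := F)
  · rw [inner_coordVec]
    split_ifs with h
    · rfl
    · by_contra h0
      exact h (hs k (Ne.symm h0))

theorem stronglyMeasurable_coordVec [Countable s] : StronglyMeasurable (coordVec b s) := by
  have hlim : Tendsto (fun (F : Finset s) (x : coordBall s) => ∑ i ∈ F, x.1 i • b i) atTop
      (𝓝 (coordVec b s)) := by
    refine tendsto_pi_nhds.2 fun x => ?_
    have h := hasSum_coordVec b s x
    rwa [HasSum, SummationFilter.unconditional_filter] at h
  refine stronglyMeasurable_of_tendsto atTop (fun F => ?_) hlim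
  refine Continuous.stronglyMeasurable (continuous_finsetSum _ fun i _ => ?_)
  exact ((continuous_apply i).comp continuous_subtype_val).smul continuous_const

end Coordinates

/-! ### Mixtures of product vectors of norm at most one -/

section Mixture

open Filter Topology

variable {A B I J : Type*} [NormedAddCommGroup A] [InnerProductSpace ℂ A] [CompleteSpace A]
  [NormedAddCommGroup B] [InnerProductSpace ℂ B] [CompleteSpace B]
  (e : HilbertBasis I ℂ A) (f : HilbertBasis J ℂ B) (s : Set I) (t : Set J)

/-- The product of the two vectors with given coordinates. -/
noncomputable def coordProduct (k : coordBall s × coordBall t) : HilbertTensor A B :=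
  productVector (coordVec e s k.1) (coordVec f t k.2)

theorem norm_coordProduct_le (k : coordBall s × coordBall t) : ‖coordProduct e f s t k‖ ≤ 1 := by
  rw [coordProduct, norm_productVector]
  exact mul_le_one₀ (norm_coordVec_le e s _) (norm_nonneg _) (norm_coordVec_le f t _)

theorem continuous_inner_coordProduct (p : I × J) :
    Continuous fun k => inner ℂ (productBasis e f p) (coordProduct e f s t k) := by
  simp only [coordProduct, productBasis_apply, inner_productVector]
  exact ((continuous_inner_coordVec e s p.1).comp continuous_fst).mul
    ((continuous_inner_coordVec f t p.2).comp continuous_snd)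

theorem inner_coordProduct_of_notMem {p : I × J} (hp : p ∉ s ×ˢ t)
    (k : coordBall s × coordBall t) :
    inner ℂ (productBasis e f p) (coordProduct e f s t k) = 0 := by
  rw [productBasis_apply, coordProduct, inner_productVector]
  by_cases h : p.1 ∈ s
  · rw [inner_coordVec_of_notMem f t (fun h' => hp ⟨h, h'⟩), mul_zero]
  · rw [inner_coordVec_of_notMem e s h, zero_mul]

/-- The matrix elements of `|a ⊗ b⟩⟨a ⊗ b|` depend continuously on the coordinates of `a` and `b`
in the product topology, although the operator itself does not. -/
theorem continuous_matrixElement_coordProduct (p q : I × J) :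
    Continuous fun k => matrixElement (productBasis e f p) (productBasis e f q)
      (ketBra (coordProduct e f s t k) (coordProduct e f s t k)) := by
  have h : ∀ k, matrixElement (productBasis e f p) (productBasis e f q)
      (ketBra (coordProduct e f s t k) (coordProduct e f s t k)) =
      (starRingEnd ℂ) (inner ℂ (productBasis e f q) (coordProduct e f s t k)) *
        inner ℂ (productBasis e f p) (coordProduct e f s t k) := by
    intro k
    rw [matrixElement_apply, op_ketBra, InnerProductSpace.rankOne_apply, inner_smul_right,
      inner_conj_symm]
  simp_rw [h]
  exact (Complex.continuous_conj.comp (continuous_inner_coordProduct e f s t q)).mul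
    (continuous_inner_coordProduct e f s t p)

theorem stronglyMeasurable_coordProduct [Countable s] [Countable t] :
    StronglyMeasurable (coordProduct e f s t) :=
  continuous_productVector.comp_stronglyMeasurable
    (((stronglyMeasurable_coordVec e s).comp_measurable measurable_fst).prodMk
      ((stronglyMeasurable_coordVec f t).comp_measurable measurable_snd))

/-- The matrix of the operator `∫ |a ⊗ b⟩⟨a ⊗ b| dμ` in the product basis. -/
noncomputable def mixtureMatrix (μ : ProbabilityMeasure (coordBall s × coordBall t))
    (p q : I × J) : ℂ :=
  ∫ k, matrixElement (productBasis e f p) (productBasis e f q)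
    (ketBra (coordProduct e f s t k) (coordProduct e f s t k))
    ∂(μ : Measure (coordBall s × coordBall t))

theorem integrable_matrixElement_coordProduct [Countable s] [Countable t] (p q : I × J)
    (μ : Measure (coordBall s × coordBall t)) [IsFiniteMeasure μ] :
    Integrable (fun k => matrixElement (productBasis e f p) (productBasis e f q)
      (ketBra (coordProduct e f s t k) (coordProduct e f s t k))) μ :=
  (BoundedContinuousFunction.mkOfCompact
    ⟨_, continuous_matrixElement_coordProduct e f s t p q⟩).integrable μ

theorem isClosed_range_mixtureMatrix [Countable s] [Countable t] :
    IsClosed (Set.range (mixtureMatrix e f s t)) := by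
  have := compactSpace_probabilityMeasure (X := coordBall s × coordBall t)
  refine (isCompact_range (continuous_pi fun p => continuous_pi fun q => ?_)).isClosed
  rw [continuous_iff_continuousAt]
  intro μ
  exact (ProbabilityMeasure.tendsto_iff_forall_integral_rclike_tendsto ℂ).1 tendsto_id
    (BoundedContinuousFunction.mkOfCompact
      ⟨_, continuous_matrixElement_coordProduct e f s t p q⟩)

theorem convex_range_mixtureMatrix [Countable s] [Countable t] :
    Convex ℝ (Set.range (mixtureMatrix e f s t)) := by
  rintro _ ⟨μ, rfl⟩ _ ⟨ν, rfl⟩ a b ha hb hab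
  have hprob : IsProbabilityMeasure (ENNReal.ofReal a • (μ : Measure (coordBall s × coordBall t)) +
      ENNReal.ofReal b • (ν : Measure (coordBall s × coordBall t))) := ⟨by
    simp [← ENNReal.ofReal_add ha hb, hab]⟩
  refine ⟨⟨_, hprob⟩, ?_⟩
  ext p q
  simp only [mixtureMatrix, ProbabilityMeasure.coe_mk, Pi.add_apply, Pi.smul_apply]
  rw [integral_add_measure, integral_smul_measure, integral_smul_measure,
    ENNReal.toReal_ofReal ha, ENNReal.toReal_ofReal hb]
  · exact (integrable_matrixElement_coordProduct e f s t p q _).smul_measure ENNReal.ofReal_ne_top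
  · exact (integrable_matrixElement_coordProduct e f s t p q _).smul_measure ENNReal.ofReal_ne_top

/-- A point of the closed convex hull of a set lies in that of a countable subset. -/
theorem exists_countable_mem_closure_convexHull {E : Type*} [NormedAddCommGroup E]
    [NormedSpace ℝ E] {D : Set E} {x : E} (hx : x ∈ closure (convexHull ℝ D)) :
    ∃ D' ⊆ D, D'.Countable ∧ x ∈ closure (convexHull ℝ D') := by
  obtain ⟨u, hu, hlim⟩ := mem_closure_iff_seq_limit.1 hx
  have h : ∀ n, ∃ F : Finset E, (F : Set E) ⊆ D ∧ u n ∈ convexHull ℝ (F : Set E) := by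
    intro n
    have := hu n
    rw [convexHull_eq_union_convexHull_finite_subsets] at this
    simpa using this
  choose F hFD hF using h
  refine ⟨⋃ n, (F n : Set E), Set.iUnion_subset hFD, Set.countable_iUnion fun n =>
    (F n).countable_toSet, mem_closure_of_tendsto hlim (Eventually.of_forall fun n => ?_)⟩
  exact convexHull_mono (Set.subset_iUnion (fun n => (F n : Set E)) n) (hF n)

/-- The matrix of a separable operator is that of a mixture of product vectors. The mixing measure
is a limit of measures with finite support, which exists by compactness. -/
theorem exists_mixtureMatrix_eq {Γ : TraceClass (HilbertTensor A B)}
    (hΓ : Γ ∈ closure (convexHull ℝ (pureProductStates A B))) :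
    ∃ (s : Set I) (t : Set J) (_ : Countable s) (_ : Countable t)
      (μ : ProbabilityMeasure (coordBall s × coordBall t)),
      ∀ p q, mixtureMatrix e f s t μ p q =
        matrixElement (productBasis e f p) (productBasis e f q) Γ := by
  obtain ⟨D, hD, hDc, hΓD⟩ := exists_countable_mem_closure_convexHull hΓ
  have := hDc.to_subtype
  choose a b ha hb hab using fun d : D => hD d.2
  -- the coordinates which occur in one of the countably many product vectors
  let s : Set I := ⋃ d, {i | inner ℂ (e i) (a d) ≠ 0}
  let t : Set J := ⋃ d, {j | inner ℂ (f j) (b d) ≠ 0}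
  have hs : s.Countable := Set.countable_iUnion fun d => by
    simpa [Function.support] using
      (e.orthonormal.inner_products_summable (a d)).countable_support
  have ht : t.Countable := Set.countable_iUnion fun d => by
    simpa [Function.support] using
      (f.orthonormal.inner_products_summable (b d)).countable_support
  have hs' := hs.to_subtype
  have ht' := ht.to_subtype
  let m : TraceClass (HilbertTensor A B) →ₗ[ℝ] (I × J → I × J → ℂ) :=
    { toFun := fun T p q => matrixElement (productBasis e f p) (productBasis e f q) T
      map_add' := fun S T => by ext p q; simp only [map_add, Pi.add_apply]
      map_smul' := fun c T => by
        ext p q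
        simp only [Pi.smul_apply, RingHom.id_apply]
        exact ((matrixElement (productBasis e f p) (productBasis e f q)).restrictScalars
          ℝ).map_smul c T }
  have hm : Continuous m := continuous_pi fun p => continuous_pi fun q =>
    (matrixElement (productBasis e f p) (productBasis e f q)).continuous
  have hsub : closure (convexHull ℝ D) ⊆ m ⁻¹' Set.range (mixtureMatrix e f s t) := by
    refine closure_minimal (convexHull_min ?_ ?_) ((isClosed_range_mixtureMatrix e f s t).preimage hm)
    · intro d hd
      obtain ⟨x, hx⟩ := exists_coordVec_eq e s (ha ⟨d, hd⟩) fun i hi =>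
        Set.mem_iUnion.2 ⟨⟨d, hd⟩, hi⟩
      obtain ⟨y, hy⟩ := exists_coordVec_eq f t (hb ⟨d, hd⟩) fun j hj =>
        Set.mem_iUnion.2 ⟨⟨d, hd⟩, hj⟩
      refine ⟨⟨Measure.dirac (x, y), inferInstance⟩, ?_⟩
      ext p q
      have hd' : d = ketBra (coordProduct e f s t (x, y)) (coordProduct e f s t (x, y)) := by
        rw [coordProduct, hx, hy]; exact hab ⟨d, hd⟩
      simp only [mixtureMatrix, ProbabilityMeasure.coe_mk]
      rw [integral_dirac]
      exact congrArg _ hd'.symm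
    · exact (convex_range_mixtureMatrix e f s t).linear_preimage m
  obtain ⟨μ, hμ⟩ := hsub hΓD
  exact ⟨s, t, hs', ht', μ, fun p q => congrFun (congrFun hμ p) q⟩

/-- No mass escapes in the limit: if the mixture has the matrix of a state, then almost all of
its product vectors are unit vectors, because their squared norms are at most one and average to
the trace. -/
theorem ae_norm_coordProduct_eq_one [Countable s] [Countable t]
    {Γ : TraceClass (HilbertTensor A B)} (hΓ : IsState Γ)
    (μ : ProbabilityMeasure (coordBall s × coordBall t))
    (hμ : ∀ p q, mixtureMatrix e f s t μ p q =
      matrixElement (productBasis e f p) (productBasis e f q) Γ) :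
    ∀ᵐ k ∂(μ : Measure (coordBall s × coordBall t)), ‖coordProduct e f s t k‖ = 1 := by
  have hcount : Countable ↥(s ×ˢ t) :=
    (Set.Countable.prod (Set.to_countable s) (Set.to_countable t)).to_subtype
  have hmeas : ∀ p, Measurable fun k =>
      ‖inner ℂ (productBasis e f p) (coordProduct e f s t k)‖ₑ ^ 2 := fun p =>
    ((continuous_inner_coordProduct e f s t p).enorm.measurable).pow_const 2
  have hdiag : ∀ p, ∫⁻ k, ‖inner ℂ (productBasis e f p) (coordProduct e f s t k)‖ₑ ^ 2
      ∂(μ : Measure (coordBall s × coordBall t)) =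
      ENNReal.ofReal (RCLike.re (inner ℂ (productBasis e f p) (Γ.op (productBasis e f p)))) := by
    intro p
    have h1 := hμ p p
    have h2 : ∀ k, matrixElement (productBasis e f p) (productBasis e f p)
        (ketBra (coordProduct e f s t k) (coordProduct e f s t k)) =
        ((‖inner ℂ (productBasis e f p) (coordProduct e f s t k)‖ ^ 2 : ℝ) : ℂ) := by
      intro k
      rw [matrixElement_apply, op_ketBra, InnerProductSpace.rankOne_apply, inner_smul_right,
        ← inner_conj_symm, Complex.conj_mul', Complex.ofReal_pow]
    rw [mixtureMatrix] at h1
    simp_rw [h2] at h1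
    rw [integral_complex_ofReal, matrixElement_apply] at h1
    have hint : Integrable (fun k =>
        ‖inner ℂ (productBasis e f p) (coordProduct e f s t k)‖ ^ 2)
        (μ : Measure (coordBall s × coordBall t)) :=
      (BoundedContinuousFunction.mkOfCompact
        ⟨_, (continuous_inner_coordProduct e f s t p).norm.pow 2⟩).integrable _
    rw [← h1, RCLike.re_to_complex, Complex.ofReal_re,
      ofReal_integral_eq_lintegral_ofReal hint (ae_of_all _ fun k => by positivity)]
    refine lintegral_congr fun k => ?_
    rw [ENNReal.ofReal_pow (norm_nonneg _), ofReal_norm]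
  have hrestrict : ∀ g : I × J → ℝ≥0∞, (∀ p ∉ s ×ˢ t, g p = 0) →
      ∑' p, g p = ∑' p : ↥(s ×ˢ t), g p := by
    intro g hg
    refine (tsum_subtype_eq_of_support_subset fun p hp => ?_).symm
    by_contra h
    exact hp (hg p h)
  have htot : ∫⁻ k, ‖coordProduct e f s t k‖ₑ ^ 2
      ∂(μ : Measure (coordBall s × coordBall t)) = 1 := by
    calc ∫⁻ k, ‖coordProduct e f s t k‖ₑ ^ 2 ∂(μ : Measure (coordBall s × coordBall t))
        = ∫⁻ k, ∑' p : ↥(s ×ˢ t), ‖inner ℂ (productBasis e f p) (coordProduct e f s t k)‖ₑ ^ 2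
          ∂(μ : Measure (coordBall s × coordBall t)) := by
          refine lintegral_congr fun k => ?_
          rw [parseval (productBasis e f), hrestrict]
          intro p hp
          rw [inner_coordProduct_of_notMem e f s t hp]
          simp
      _ = ∑' p : ↥(s ×ˢ t), ∫⁻ k, ‖inner ℂ (productBasis e f p) (coordProduct e f s t k)‖ₑ ^ 2
          ∂(μ : Measure (coordBall s × coordBall t)) :=
          lintegral_tsum fun p => (hmeas p).aemeasurable
      _ = ∑' p, ∫⁻ k, ‖inner ℂ (productBasis e f p) (coordProduct e f s t k)‖ₑ ^ 2
          ∂(μ : Measure (coordBall s × coordBall t)) := by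
          rw [← hrestrict fun p => ∫⁻ k, ‖inner ℂ (productBasis e f p)
            (coordProduct e f s t k)‖ₑ ^ 2 ∂(μ : Measure (coordBall s × coordBall t))]
          intro p hp
          simp only [inner_coordProduct_of_notMem e f s t hp]
          simp
      _ = 1 := by
          simp_rw [hdiag]
          rw [← hΓ.traceNorm_eq_one, traceNorm_eq_tsum (productBasis e f),
            CFC.abs_of_nonneg _ ((ContinuousLinearMap.nonneg_iff_isPositive _).2 hΓ.1)]
  have hle : ∀ k, ‖coordProduct e f s t k‖ₑ ^ 2 ≤ 1 := by
    intro k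
    refine pow_le_one' ?_ 2
    rw [← ofReal_norm]
    exact ENNReal.ofReal_le_one.2 (norm_coordProduct_le e f s t k)
  have hae := ae_eq_of_ae_le_of_lintegral_le (μ := (μ : Measure (coordBall s × coordBall t)))
    (g := fun _ => 1) (ae_of_all _ hle) (by rw [htot]; exact ENNReal.one_ne_top)
    aemeasurable_const (by rw [htot]; simp)
  filter_upwards [hae] with k hk
  have h := congrArg ENNReal.toReal hk
  simpa [pow_eq_one_iff_of_nonneg] using h

end Mixture

/-! ### Separable states as barycenters -/

section Barycenter

variable {A B : Type*} [NormedAddCommGroup A] [InnerProductSpace ℂ A]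
  [NormedAddCommGroup B] [InnerProductSpace ℂ B]

theorem one_le_schmidtNumber (Γ : TraceClass (HilbertTensor A B)) : 1 ≤ schmidtNumber Γ := by
  refine le_iInf₂ fun μ _ => ?_
  rw [← essSup_const (1 : ℕ∞) (IsProbabilityMeasure.ne_zero
    (μ : Measure (pureStates (HilbertTensor A B))))]
  exact essSup_mono_ae (Filter.Eventually.of_forall one_le_pureSchmidtRank)

variable [CompleteSpace A] [CompleteSpace B]

/-- A state is separable if it is a barycenter of pure states of which almost all are products. -/
theorem isSeparable_of_schmidtNumber_le_one {Γ : TraceClass (HilbertTensor A B)}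
    (h : schmidtNumber Γ ≤ 1) : IsSeparable Γ := by
  -- the Schmidt numbers are well-ordered, so that the infimum is attained
  have h2 : schmidtNumber Γ < 2 := lt_of_le_of_lt h (by norm_num)
  obtain ⟨μ, hμ⟩ := iInf_lt_iff.1 h2
  obtain ⟨⟨hint, hbar⟩, hlt⟩ := iInf_lt_iff.1 hμ
  have hle : essSup pureSchmidtRank (μ : Measure (pureStates (HilbertTensor A B))) ≤ 1 :=
    Order.le_of_lt_add_one (by rwa [one_add_one_eq_two])
  rw [IsSeparable, separableStates_eq, ← hbar]
  refine (convex_convexHull ℝ _).closure.integral_mem isClosed_closure ?_ hint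
  filter_upwards [ae_le_essSup (f := pureSchmidtRank)
    (μ := (μ : Measure (pureStates (HilbertTensor A B))))] with P hP
  exact subset_closure (subset_convexHull ℝ _ ((pureSchmidtRank_le_one_iff P).1 (hP.trans hle)))

/-- A separable state is the barycenter of a measure on the pure product states. -/
theorem exists_isBarycenter_of_isSeparable {Γ : TraceClass (HilbertTensor A B)} (hΓ : IsState Γ)
    (h : IsSeparable Γ) :
    ∃ μ : ProbabilityMeasure (pureStates (HilbertTensor A B)), IsBarycenter μ Γ ∧
      ∀ᵐ P ∂(μ : Measure (pureStates (HilbertTensor A B))), pureSchmidtRank P ≤ 1 := by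
  classical
  rw [IsSeparable, separableStates_eq] at h
  obtain ⟨s, t, _, _, μ, hμ⟩ := exists_mixtureMatrix_eq (basis A) (basis B) h
  have hae := ae_norm_coordProduct_eq_one _ _ s t hΓ μ hμ
  set Ψ := coordProduct (basis A) (basis B) s t with hΨ
  have hΨm : StronglyMeasurable Ψ := stronglyMeasurable_coordProduct _ _ s t
  -- an arbitrary unit product vector replaces those which are not of norm one
  obtain ⟨k₀, hk₀⟩ := hae.exists
  let Φ : coordBall s × coordBall t → HilbertTensor A B := fun k => if ‖Ψ k‖ = 1 then Ψ k else Ψ k₀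
  have hset : MeasurableSet {k | ‖Ψ k‖ = 1} := hΨm.norm.measurable (measurableSet_singleton 1)
  have hΦm : StronglyMeasurable Φ := hΨm.ite hset stronglyMeasurable_const
  have hΦn : ∀ k, ‖Φ k‖ = 1 := by
    intro k
    by_cases hk : ‖Ψ k‖ = 1
    · simp [Φ, hk]
    · simp [Φ, hk, hk₀]
  have hΦp : ∀ k, ∃ a b, Φ k = productVector a b := by
    intro k
    by_cases hk : ‖Ψ k‖ = 1
    · exact ⟨_, _, if_pos hk⟩
    · exact ⟨_, _, if_neg hk⟩
  let Q : coordBall s × coordBall t → pureStates (HilbertTensor A B) :=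
    fun k => ⟨ketBra (Φ k) (Φ k), ketBra_mem_pureStates (hΦn k)⟩
  have hQs : StronglyMeasurable fun k => (Q k : TraceClass (HilbertTensor A B)) :=
    continuous_ketBra_self.comp_stronglyMeasurable hΦm
  have hQm : Measurable Q := hQs.measurable.subtype_mk
  have hQr : ∀ k, pureSchmidtRank (Q k) ≤ 1 := by
    intro k
    obtain ⟨a, b, hab⟩ := hΦp k
    rw [pureSchmidtRank_le_one_iff]
    simp only [Q, hab]
    exact ketBra_mem_pureProductStates (hab ▸ hΦn k)
  have hprob : IsProbabilityMeasure
      ((μ : Measure (coordBall s × coordBall t)).map Q) :=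
    Measure.isProbabilityMeasure_map hQm.aemeasurable
  -- `S_1` need not be separable, but almost all values lie in a closed separable set
  have hcoe : AEStronglyMeasurable (fun P : pureStates (HilbertTensor A B) =>
      (P : TraceClass (HilbertTensor A B)))
      ((μ : Measure (coordBall s × coordBall t)).map Q) := by
    rw [aestronglyMeasurable_iff_aemeasurable_separable]
    refine ⟨measurable_subtype_coe.aemeasurable, _, hQs.isSeparable_range.closure, ?_⟩
    rw [ae_map_iff hQm.aemeasurable (isClosed_closure.measurableSet.preimage
      measurable_subtype_coe)]
    exact ae_of_all _ fun k => subset_closure ⟨k, rfl⟩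
  have hbound : ∀ P : pureStates (HilbertTensor A B),
      ‖(P : TraceClass (HilbertTensor A B))‖ ≤ 1 := by
    rintro ⟨P, Ψ, hΨ, hP⟩
    have hP' : P = ketBra Ψ Ψ := TraceClass.op_injective hP
    simpa [hP', hΨ] using norm_ketBra_le Ψ Ψ
  have hint : Integrable (fun P : pureStates (HilbertTensor A B) =>
      (P : TraceClass (HilbertTensor A B)))
      ((μ : Measure (coordBall s × coordBall t)).map Q) :=
    Integrable.of_bound hcoe 1 (ae_of_all _ hbound)
  have hintQ : Integrable (fun k => (Q k : TraceClass (HilbertTensor A B)))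
      (μ : Measure (coordBall s × coordBall t)) :=
    Integrable.of_bound hQs.aestronglyMeasurable 1 (ae_of_all _ fun k => hbound _)
  refine ⟨⟨_, hprob⟩, ⟨hint, ?_⟩, ?_⟩
  · rw [ProbabilityMeasure.coe_mk, integral_map hQm.aemeasurable hcoe]
    refine ext_of_matrixElement (productBasis (basis A) (basis B)) fun p q => ?_
    rw [← ContinuousLinearMap.integral_comp_comm _ hintQ, ← hμ p q, mixtureMatrix]
    refine integral_congr_ae ?_
    filter_upwards [hae] with k hk
    have hk' : Φ k = Ψ k := if_pos hk
    simp only [Q, hk', hΨ]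
  · -- the set of product states is closed, hence measurable
    rw [ProbabilityMeasure.coe_mk]
    simp_rw [pureSchmidtRank_le_one_iff] at hQr ⊢
    rw [ae_map_iff hQm.aemeasurable isClosed_setOf_pureProductStates.measurableSet]
    exact ae_of_all _ hQr

theorem isSeparable_iff_schmidtNumber_le_one {Γ : TraceClass (HilbertTensor A B)}
    (hΓ : IsState Γ) : IsSeparable Γ ↔ schmidtNumber Γ ≤ 1 := by
  refine ⟨fun h => ?_, isSeparable_of_schmidtNumber_le_one⟩
  obtain ⟨μ, hμ, hr⟩ := exists_isBarycenter_of_isSeparable hΓ h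
  exact (iInf₂_le μ hμ).trans (essSup_le_of_ae_le 1 hr)

end Barycenter

end SchmidtNumber

theorem theorem1p4 {A B : Type*}
    [NormedAddCommGroup A] [InnerProductSpace ℂ A] [CompleteSpace A]
    [NormedAddCommGroup B] [InnerProductSpace ℂ B] [CompleteSpace B]
    (Γ : SchmidtNumber.TraceClass (SchmidtNumber.HilbertTensor A B))
    (hΓ : SchmidtNumber.IsState Γ) :
    (SchmidtNumber.IsEntangled Γ ↔ 1 < SchmidtNumber.schmidtNumber Γ) ∧
      (SchmidtNumber.IsSeparable Γ ↔ SchmidtNumber.schmidtNumber Γ = 1) := by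
  have h1 := SchmidtNumber.one_le_schmidtNumber Γ
  have h := SchmidtNumber.isSeparable_iff_schmidtNumber_le_one hΓ
  exact ⟨by rw [SchmidtNumber.IsEntangled, h, not_le], by rw [h, le_antisymm_iff, and_iff_left h1]⟩
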